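/- Let $c_{44},K_2,\rho,\omega>0$ and $R_3\ge 0$ be real with $c_{44}K_2-R_3^2>0$, and put $C=\begin{pmatrix}c_{44}&R_3\\R_3&K_2\end{pmatrix}$, $a_{1,2}=\tfrac12\big(\operatorname{tr}C\pm\sqrt{(\operatorname{tr}C)^2-4\det C}\big)$, $k_l=\sqrt{\rho/a_l}\,\omega$, $\psi=\arccos\dfrac{R_3}{\sqrt{(c_{44}-a_1)^2+R_3^2}}$ (with $\psi=0$ if this quotient is $0/0$, i.e. if $R_3=0$ and $c_{44}=a_1$), and $Q=\begin{pmatrix}\cos\psi&-\sin\psi\\ \sin\psi&\cos\psi\end{pmatrix}$. Let $K_0$ be the modified Bessel function, $K_0(-ix)=\tfrac{\pi i}{2}H^{(1)}_0(x)$ for $x>0$, and define the $2\times 2$ matrix function $$v^*(r,\omega)=Q\begin{pmatrix}\frac{\cos\psi}{2\pi a_1}K_0(-ik_1r)&\frac{\sin\psi}{2\pi a_1}K_0(-ik_1r)\\[2pt] \frac{-\sin\psi}{2\pi a_2}K_0(-ik_2r)&\frac{\cos\psi}{2\pi a_2}K_0(-ik_2r)\end{pmatrix}.$$ Let $\xi=(\xi_1,\xi_2)$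 with $\xi_2<0$, $r=\sqrt{(x_1-\xi_1)^2+(x_2-\xi_2)^2}$, and let $\tilde r=\sqrt{(x_1-\xi_1)^2+(x_2+\xi_2)^2}$ be the distance from $x$ to the image point $(\xi_1,-\xi_2)$. Put $$y(x,\xi,\omega)=v^*(\tilde r,\omega),\qquad g^*(x,\xi,\omega)=v^*(r,\omega)+y(x,\xi,\omega).$$ Rows $1,2$ of these matrices are the phonon and phason displacements, and the column $j$ belongs to the $j$-th source. Then $g^*$ is a Green's function of the half-plane $\mathbb R^2_-=\{x_2<0\}$ with traction-free boundary: 1. Each column $(u,w)$ of $y$ is a $C^2$ solution in $\mathbb R^2_-$ of $c_{44}\Delta u+R_3\Delta w+\rho\omega^2u=0$, $R_3\Delta u+K_2\Delta w+\rho\omega^2w=0$; and $g^*$ is $C^2$ at every $x\neq\xi$ with $x_2\le0$. 2. $g^*$ is locally integrable in $\mathbb R^2_-$ and in the sense of distributions on $\mathbb R^2_-$ satisfies, for $j=1,2$, $$c_{44}\Delta g^*_{1j}+R_3\Delta g^*_{2j}+\rho\omega^2g^*_{1j}=-\delta(x-\xi)\delta_{j1},\qquad R_3\Delta g^*_{1j}+K_2\Delta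 g^*_{2j}+\rho\omega^2g^*_{2j}=-\delta(x-\xi)\delta_{j2}.$$ 3. On $x_2=0$ we have $\partial_2 v^*(r,\omega)=-\partial_2 v^*(\tilde r,\omega)$, and the phonon and phason tractions of $g^*$ vanish there: $c_{44}\partial_2g^*_{1j}+R_3\partial_2g^*_{2j}=0$ and $R_3\partial_2g^*_{1j}+K_2\partial_2g^*_{2j}=0$ for $j=1,2$. 4. $g^*$ is outgoing: with $p=(Q^{-1}g^*)_{lj}$, for $l,j=1,2$, $\sqrt{|x|}\,\big(\partial_{|x|}p-ik_l\,p\big)\to0$ as $|x|\to\infty$ in $\mathbb R^2_-$, uniformly in the direction. 5. If $R_3=0$, then $v^*(r,\omega)=\operatorname{diag}\big(\tfrac{1}{2\pi c_{44}}K_0(-i\kappa_1r),\tfrac1{2\pi K_2}K_0(-i\kappa_2r)\big)$ with $\kappa_1=\sqrt{\rho/c_{44}}\,\omega$ and $\kappa_2=\sqrt{\rho/K_2}\,\omega$, and $g^*=\operatorname{diag}(g_{c_{44}},g_{K_2})$, where $$g_\mu=\frac1{2\pi\mu}\big(K_0(-i\kappa r)+K_0(-i\kappa\tilde r)\big),\qquad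 \kappa=\sqrt{\rho/\mu}\,\omega,$$ is a Green's function of the classical isotropic anti-plane problem for each $\mu\in\{c_{44},K_2\}$: $\mu\Delta g_\mu+\rho\omega^2g_\mu=-\delta(x-\xi)$ in $\mathbb R^2_-$, $\mu\,\partial_2g_\mu=0$ on $x_2=0$, and $\sqrt{|x|}\,(\partial_{|x|}g_\mu-i\kappa g_\mu)\to0$ as $|x|\to\infty$ in $\mathbb R^2_-$, uniformly in the direction. -/

import Mathlib

open MeasureTheory Filter Topology
open scoped Laplacian

noncomputable section

namespace Quasicrystal

/-- The plane `O x₁ x₂`; the coordinates `x₁, x₂` are `x 0, x 1`. -/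
abbrev Plane : Type := EuclideanSpace ℝ (Fin 2)

/-- The lower half-plane `x₂ < 0`. -/
def lowerHalfPlane : Set Plane := {x | x 1 < 0}

/-- The unit vector in the direction `x_i`. -/
def unitVec (i : Fin 2) : Plane := EuclideanSpace.single i 1

/-- The partial derivative `f_{,i}` of a complex field at `x`. -/
def partialD (i : Fin 2) (f : Plane → ℂ) (x : Plane) : ℂ := fderiv ℝ f x (unitVec i)

/-- The modified Bessel (Macdonald, Kelvin) function `K₀` on `|arg z| < π`:
`K₀(z) = e^{-z} ∫₀^∞ e^{-t} (t² + 2zt)^{-1/2} dt` with the principal branch.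
For `Re z > 0` this is `∫₁^∞ e^{-zs} (s² - 1)^{-1/2} ds` with `s = 1 + t / z`; unlike that integral
it converges absolutely on the imaginary axis too, where `K₀(-ix) = (π i / 2) H₀⁽¹⁾(x)`, `x > 0`. -/
def besselK0 (z : ℂ) : ℂ :=
  Complex.exp (-z) *
    ∫ t in Set.Ioi (0 : ℝ), Complex.exp (-(t : ℂ)) * ((t : ℂ) ^ 2 + 2 * z * t) ^ (-(1 / 2) : ℂ)

/-- The distance from the field point `x` to the source point `ξ`. -/
def dist1 (x ξ : Plane) : ℝ := √((x 0 - ξ 0) ^ 2 + (x 1 - ξ 1) ^ 2)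

/-- The distance from the field point `x` to the image point `(ξ₁, -ξ₂)`. -/
def distImage (x ξ : Plane) : ℝ := √((x 0 - ξ 0) ^ 2 + (x 1 + ξ 1) ^ 2)

/-- The wave number `k = √(ρ / a) ω`. -/
def waveNumber (a ρ ω : ℝ) : ℝ := √(ρ / a) * ω

/-- The Sommerfeld condition `√|x| (∂p/∂|x| - i k p) → 0` as `|x| → ∞` in `Ω`, uniformly in the
direction. -/
def Sommerfeld (k : ℝ) (Ω : Set Plane) (p : Plane → ℂ) : Prop :=
  Tendsto (fun x : Plane =>
      (√‖x‖ : ℂ) * (fderiv ℝ p x (‖x‖⁻¹ • x) - Complex.I * k * p x))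
    (Bornology.cobounded Plane ⊓ 𝓟 Ω) (𝓝 0)

/-- The constants of a one-dimensional hexagonal quasicrystal: phonon elastic constant `c₄₄`,
phonon-phason coupling `R₃`, phason elastic constant `K₂`, density `ρ`. -/
structure Material where
  c44 : ℝ
  R3 : ℝ
  K2 : ℝ
  rho : ℝ

namespace Material

variable (M : Material)

/-- The matrix `C` of elastic constants. -/
def C : Matrix (Fin 2) (Fin 2) ℝ := !![M.c44, M.R3; M.R3, M.K2]

/-- The larger eigenvalue of `C`. -/
def a1 : ℝ := (M.C.trace + √(M.C.trace ^ 2 - 4 * M.C.det)) / 2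

/-- The smaller eigenvalue of `C`. -/
def a2 : ℝ := (M.C.trace - √(M.C.trace ^ 2 - 4 * M.C.det)) / 2

open Classical in
/-- The angle `ψ = arccos (R₃ / √((c₄₄ - a₁)² + R₃²))`, with `ψ = 0` when the quotient is `0 / 0`
(that is, when `R₃ = 0` and `c₄₄ ≥ K₂`, so that `C` is already diagonal with `a₁ = c₄₄`). -/
def psi : ℝ :=
  if M.R3 = 0 ∧ M.c44 = M.a1 then 0
  else Real.arccos (M.R3 / √((M.c44 - M.a1) ^ 2 + M.R3 ^ 2))

/-- The orthogonal matrix `Q` diagonalizing `C`, with complex entries. -/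
def Q : Matrix (Fin 2) (Fin 2) ℂ :=
  !![(Real.cos M.psi : ℂ), -(Real.sin M.psi : ℂ); (Real.sin M.psi : ℂ), (Real.cos M.psi : ℂ)]

/-- The wave numbers `k₁, k₂` of the two modes. -/
def k (ω : ℝ) : Fin 2 → ℝ := ![waveNumber M.a1 M.rho ω, waveNumber M.a2 M.rho ω]

/-- The matrix `h` of the decoupled system, as a function of the distance `r`. -/
def h (r ω : ℝ) : Matrix (Fin 2) (Fin 2) ℂ :=
  !![(Real.cos M.psi : ℂ) / (2 * Real.pi * M.a1) * besselK0 (-Complex.I * M.k ω 0 * r),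
     (Real.sin M.psi : ℂ) / (2 * Real.pi * M.a1) * besselK0 (-Complex.I * M.k ω 0 * r);
     -(Real.sin M.psi : ℂ) / (2 * Real.pi * M.a2) * besselK0 (-Complex.I * M.k ω 1 * r),
     (Real.cos M.psi : ℂ) / (2 * Real.pi * M.a2) * besselK0 (-Complex.I * M.k ω 1 * r)]

/-- The fundamental solution `v*(r, ω) = Q h`; row `0` holds the phonon displacements `u*₃ⱼ`,
row `1` the phason displacements `w*₃ⱼ`, column `j` belongs to the `j`-th point source. -/
def vstar (r ω : ℝ) : Matrix (Fin 2) (Fin 2) ℂ := M.Q * M.h r ω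

/-- The free-space term `x ↦ v*(r, ω)`. -/
def direct (ξ : Plane) (ω : ℝ) (x : Plane) : Matrix (Fin 2) (Fin 2) ℂ := M.vstar (dist1 x ξ) ω

/-- The correction term `y : x ↦ v*(r̃, ω)`. -/
def correction (ξ : Plane) (ω : ℝ) (x : Plane) : Matrix (Fin 2) (Fin 2) ℂ :=
  M.vstar (distImage x ξ) ω

/-- The half-plane Green's function `g* = v*(r, ω) + v*(r̃, ω)` with source `ξ`. -/
def green (ξ : Plane) (ω : ℝ) (x : Plane) : Matrix (Fin 2) (Fin 2) ℂ :=
  M.vstar (dist1 x ξ) ω + M.vstar (distImage x ξ) ω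

/-- The phonon stress `σ_{3i}` of the displacements `(u, w)`. -/
def phononStress (u w : Plane → ℂ) (x : Plane) (i : Fin 2) : ℂ :=
  M.c44 * partialD i u x + M.R3 * partialD i w x

/-- The phason stress `H_{3i}` of the displacements `(u, w)`. -/
def phasonStress (u w : Plane → ℂ) (x : Plane) (i : Fin 2) : ℂ :=
  M.R3 * partialD i u x + M.K2 * partialD i w x

/-- The phonon traction `t₃ = σ_{3i} n_i`. -/
def phononTraction (u w : Plane → ℂ) (x n : Plane) : ℂ :=
  ∑ i, M.phononStress u w x i * (n i : ℂ)

/-- The phason traction `G₃ = H_{3i} n_i`. -/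
def phasonTraction (u w : Plane → ℂ) (x n : Plane) : ℂ :=
  ∑ i, M.phasonStress u w x i * (n i : ℂ)

/-- Classical solutions in `Ω` of the time-harmonic equations of motion without sources. -/
def SolvesMotion (ω : ℝ) (Ω : Set Plane) (u w : Plane → ℂ) : Prop :=
  ContDiffOn ℝ 2 u Ω ∧ ContDiffOn ℝ 2 w Ω ∧ ∀ x ∈ Ω,
    (M.c44 : ℂ) * (Δ u) x + M.R3 * (Δ w) x + M.rho * ω ^ 2 * u x = 0 ∧
    (M.R3 : ℂ) * (Δ u) x + M.K2 * (Δ w) x + M.rho * ω ^ 2 * w x = 0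

/-- The point-source system in the open set `Ω ∋ ξ`, in the sense of distributions: for `j = 0, 1`
the column `(u, w)` of index `j` of the locally integrable matrix function `G` satisfies
`c₄₄ Δu + R₃ Δw + ρω² u = -δ(x - ξ) δ_{j0}` and `R₃ Δu + K₂ Δw + ρω² w = -δ(x - ξ) δ_{j1}`. -/
def SolvesPointSource (ω : ℝ) (Ω : Set Plane) (ξ : Plane)
    (G : Plane → Matrix (Fin 2) (Fin 2) ℂ) : Prop :=
  (∀ i j, LocallyIntegrableOn (fun x => G x i j) Ω) ∧
  ∀ φ : Plane → ℂ, ContDiff ℝ (⊤ : ℕ∞) φ → HasCompactSupport φ → tsupport φ ⊆ Ω → ∀ j : Fin 2,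
    ∫ x in Ω, ((M.c44 : ℂ) * G x 0 j * (Δ φ) x + M.R3 * G x 1 j * (Δ φ) x
        + M.rho * ω ^ 2 * G x 0 j * φ x) = -(φ ξ * if j = 0 then 1 else 0) ∧
    ∫ x in Ω, ((M.R3 : ℂ) * G x 0 j * (Δ φ) x + M.K2 * G x 1 j * (Δ φ) x
        + M.rho * ω ^ 2 * G x 1 j * φ x) = -(φ ξ * if j = 1 then 1 else 0)

/-- The phonon and phason tractions of every column of `G` vanish on `x₂ = 0` (outward unit normal
`(0, 1)`), the displacements being differentiable there. -/
def TractionFree (G : Plane → Matrix (Fin 2) (Fin 2) ℂ) : Prop :=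
  ∀ x : Plane, x 1 = 0 → ∀ j : Fin 2,
    (∀ i, DifferentiableAt ℝ (fun y => G y i j) x) ∧
    M.phononTraction (fun y => G y 0 j) (fun y => G y 1 j) x (unitVec 1) = 0 ∧
    M.phasonTraction (fun y => G y 0 j) (fun y => G y 1 j) x (unitVec 1) = 0

/-- The outgoing radiation condition in `Ω`: each row `l` of the decoupled matrix `Q⁻¹ G = Qᵀ G`
satisfies the Sommerfeld condition with the wave number `k_l` of its mode. -/
def Radiating (ω : ℝ) (Ω : Set Plane) (G : Plane → Matrix (Fin 2) (Fin 2) ℂ) : Prop :=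
  ∀ l j : Fin 2, Sommerfeld (M.k ω l) Ω (fun x => (M.Q.transpose * G x) l j)

end Material

/-- The classical isotropic anti-plane fundamental solution `(2πμ)⁻¹ K₀(-i k r)`,
`k = √(ρ / μ) ω`, for shear modulus `μ` and density `ρ`. -/
def isoFundamental (μ ρ ω r : ℝ) : ℂ :=
  1 / (2 * Real.pi * μ) * besselK0 (-Complex.I * waveNumber μ ρ ω * r)

/-- The classical isotropic anti-plane Green's function of the lower half-plane. -/
def isoGreen (μ ρ ω : ℝ) (ξ x : Plane) : ℂ :=
  1 / (2 * Real.pi * μ) * (besselK0 (-Complex.I * waveNumber μ ρ ω * dist1 x ξ)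
    + besselK0 (-Complex.I * waveNumber μ ρ ω * distImage x ξ))

/-- `p` is a half-plane Green's function of the isotropic anti-plane problem with source `ξ`:
`μ Δp + ρω² p = -δ(x - ξ)` in `x₂ < 0` in the sense of distributions, the traction `μ p_{,2}`
vanishes on `x₂ = 0`, and `p` is outgoing. -/
def IsIsotropicGreen (μ ρ ω : ℝ) (ξ : Plane) (p : Plane → ℂ) : Prop :=
  (LocallyIntegrableOn p lowerHalfPlane ∧
    ∀ φ : Plane → ℂ, ContDiff ℝ (⊤ : ℕ∞) φ → HasCompactSupport φ → tsupport φ ⊆ lowerHalfPlane →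
      ∫ x in lowerHalfPlane, ((μ : ℂ) * p x * (Δ φ) x + ρ * ω ^ 2 * p x * φ x) = -φ ξ) ∧
  (∀ x : Plane, x 1 = 0 → DifferentiableAt ℝ p x ∧ (μ : ℂ) * partialD 1 p x = 0) ∧
  Sommerfeld (waveNumber μ ρ ω) lowerHalfPlane p

end Quasicrystal

end

noncomputable section

namespace Quasicrystal

open Set

/-! The matrix C is symmetric with eigenvalues a₁, a₂, and the columns q₁, q₂ of Q are orthonormal
eigenvectors. Since `h` is diag(Φ₁, Φ₂) Qᵀ, the fundamental solution is v* = ∑ Φ_l q_l q_lᵀ, where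
Φ_l is the scalar antiplane fundamental solution of modulus a_l (`vstar_apply`). Hence g* is ∑ q_l
q_lᵀ times the scalar half-plane Green's functions (`green_apply`). C acts on mode l as a_l, and ∑
q_l q_lᵀ = 1 supplies the Kronecker delta of the sources, so everything reduces to one scalar
problem.

In the scalar problem the image point lies outside the half-plane: it adds no source, and by
reflection it cancels the normal derivative on the boundary. What remains is that K₀(-iκ|x -
p|)/(2π) is an outgoing fundamental solution of -(Δ + κ²).

This is read off from K₀(-ix) = ∫₀^∞ e^{(i-s)x} w(s) ds with w = (s² - 2is)^{-1/2}
(`outgoingProfile_eq`). Bessel's equation holds because the integrand it produces is an exact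
s-derivative (`outgoingLaplace_bessel`). From |s w| ≤ 1 comes K' - iK = O(1/x), the radiation
condition; from s w → 1 comes x K' → -1, the strength of the singularity. In polar coordinates about
the source, Green's identity along each ray turns that limit into the point mass, while the angular
terms integrate to zero (`integral_outgoingField_mul`). -/

/-- The improper fundamental theorem of calculus on `(a, ∞)` with limits at both ends. -/
theorem integral_Ioi_of_hasDerivAt_of_tendsto_of_tendsto {f f' : ℝ → ℂ} {a : ℝ} {m n : ℂ}
    (hderiv : ∀ x ∈ Ioi a, HasDerivAt f (f' x) x) (hint : IntegrableOn f' (Ioi a))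
    (h0 : Tendsto f (𝓝[>] a) (𝓝 m)) (htop : Tendsto f atTop (𝓝 n)) :
    ∫ x in Ioi a, f' x = n - m := by
  have h := integral_Ioi_deriv_mul_eq_sub (u := f) (v := fun _ => 1) (u' := f') (v' := fun _ => 0)
    (a := a) (a' := m) (b' := n) hderiv (fun x _ => hasDerivAt_const x 1)
    (by simpa [Pi.mul_def, Pi.add_def] using hint) (by simpa [Pi.mul_def] using h0)
    (by simpa [Pi.mul_def] using htop)
  simpa using h

/-! ### Laplace integrals with an oscillating factor, differentiated under the integral sign. -/

/-- Weights `w` on `(0, ∞)` whose Laplace transform converges absolutely in the open half-line. -/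
def LaplaceIntegrable (w : ℝ → ℂ) : Prop :=
  ∀ y : ℝ, 0 < y → IntegrableOn (fun s : ℝ => Complex.exp (-(y * s : ℝ)) * w s) (Ioi 0)

/-- The Laplace integral `∫₀^∞ e^{(i - s) x} w(s) ds`. -/
def outgoingLaplace (w : ℝ → ℂ) (x : ℝ) : ℂ :=
  ∫ s in Ioi (0 : ℝ), Complex.exp ((Complex.I - s) * x) * w s

theorem norm_exp_I_sub_mul (s x : ℝ) :
    ‖Complex.exp ((Complex.I - s) * x)‖ = Real.exp (-(x * s)) := by
  rw [Complex.norm_exp]; congr 1; simp; ring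

/-- The integrable function for y = 1, multiplied by the continuous e^s, gives back w. -/
theorem LaplaceIntegrable.aestronglyMeasurable {w : ℝ → ℂ} (hw : LaplaceIntegrable w) :
    AEStronglyMeasurable w (volume.restrict (Ioi 0)) := by
  have h := (hw 1 one_pos).aestronglyMeasurable
  have h2 : AEStronglyMeasurable (fun s : ℝ => Complex.exp ((1 * s : ℝ)))
      (volume.restrict (Ioi 0)) := (by fun_prop : Continuous _).aestronglyMeasurable
  refine (h2.mul h).congr (Eventually.of_forall fun s => ?_)
  simp only [Pi.mul_apply]
  rw [← mul_assoc, ← Complex.exp_add]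
  simp

theorem LaplaceIntegrable.integrableOn_exp {w : ℝ → ℂ} (hw : LaplaceIntegrable w) {x : ℝ}
    (hx : 0 < x) :
    IntegrableOn (fun s : ℝ => Complex.exp ((Complex.I - s) * x) * w s) (Ioi 0) := by
  refine Integrable.mono (hw x hx) ?_ (Eventually.of_forall fun s => ?_)
  · exact (by fun_prop : Continuous _).aestronglyMeasurable.mul hw.aestronglyMeasurable
  · rw [norm_mul, norm_mul, norm_exp_I_sub_mul, ← Complex.ofReal_neg, ← Complex.ofReal_exp,
      Complex.norm_real, Real.norm_eq_abs, Real.abs_exp]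

/-- Half of the exponential decay pays for linear growth: e^{ys/2} ≥ 1 + ys/2 gives 1 + s ≤ (1 +
2/y) e^{ys/2}. The class of weights is therefore stable under the factor i - s that each
differentiation produces. -/
theorem LaplaceIntegrable.mul_of_norm_le {w v : ℝ → ℂ} (hw : LaplaceIntegrable w)
    (hv : Continuous v) (hle : ∀ s, 0 < s → ‖v s‖ ≤ 1 + s) :
    LaplaceIntegrable (fun s => v s * w s) := by
  intro y hy
  refine ((hw (y / 2) (by positivity)).norm.const_mul (1 + 2 / y)).mono' ?_ ?_
  · exact (by fun_prop : Continuous _).aestronglyMeasurable.mul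
      (hv.aestronglyMeasurable.mul hw.aestronglyMeasurable)
  · filter_upwards [ae_restrict_mem measurableSet_Ioi] with s hs
    have hs : 0 < s := hs
    have h1 : 1 + s ≤ (1 + 2 / y) * Real.exp (y / 2 * s) := by
      have := Real.add_one_le_exp (y / 2 * s)
      have h2 : 0 < 2 / y := by positivity
      have h3 : 2 / y * (y / 2 * s) = s := by field_simp
      have h4 : 0 < y / 2 * s := by positivity
      nlinarith [mul_le_mul_of_nonneg_left this h2.le]
    have h5 : Real.exp (-(y * s)) = Real.exp (-(y / 2 * s)) * (Real.exp (y / 2 * s))⁻¹ := by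
      rw [← Real.exp_neg, ← Real.exp_add]; ring_nf
    simp only [norm_mul, ← Complex.ofReal_neg, ← Complex.ofReal_exp, Complex.norm_real,
      Real.norm_eq_abs, Real.abs_exp]
    rw [h5]
    have hE := Real.exp_pos (y / 2 * s)
    calc Real.exp (-(y / 2 * s)) * (Real.exp (y / 2 * s))⁻¹ * (‖v s‖ * ‖w s‖)
        ≤ Real.exp (-(y / 2 * s)) * (Real.exp (y / 2 * s))⁻¹ *
          (((1 + 2 / y) * Real.exp (y / 2 * s)) * ‖w s‖) := by
          gcongr; exact (hle s hs).trans h1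
      _ = (1 + 2 / y) * (Real.exp (-(y / 2 * s)) * ‖w s‖) := by field_simp

theorem LaplaceIntegrable.I_sub_mul {w : ℝ → ℂ} (hw : LaplaceIntegrable w) :
    LaplaceIntegrable (fun s => (Complex.I - s) * w s) := by
  refine hw.mul_of_norm_le (by fun_prop) fun s hs => ?_
  refine (norm_sub_le _ _).trans ?_
  simp [abs_of_pos hs]

theorem hasDerivAt_outgoingLaplace {w : ℝ → ℂ} (hw : LaplaceIntegrable w) {x : ℝ} (hx : 0 < x) :
    HasDerivAt (outgoingLaplace w) (outgoingLaplace (fun s => (Complex.I - s) * w s) x) x := by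
  have hw' := hw.I_sub_mul
  -- On the neighbourhood (x/2, ∞) of x all exponentials are dominated by e^{-xs/2}.
  refine (hasDerivAt_integral_of_dominated_loc_of_deriv_le (s := Ioi (x / 2))
    (F := fun x s => Complex.exp ((Complex.I - (s : ℝ)) * (x : ℝ)) * w s)
    (F' := fun x s => Complex.exp ((Complex.I - (s : ℝ)) * (x : ℝ)) * ((Complex.I - s) * w s))
    (bound := fun s => ‖Complex.exp (-(x / 2 * s : ℝ)) * ((Complex.I - s) * w s)‖)
    (Ioi_mem_nhds (by linarith)) (Eventually.of_forall fun y => ?_) (hw.integrableOn_exp hx)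
    (hw'.integrableOn_exp hx).aestronglyMeasurable ?_ (hw' _ (by positivity)).norm ?_).2
  · exact (by fun_prop : Continuous _).aestronglyMeasurable.mul hw.aestronglyMeasurable
  · filter_upwards [ae_restrict_mem measurableSet_Ioi] with s hs y hy
    rw [norm_mul, norm_mul _ ((Complex.I - s) * w s), norm_exp_I_sub_mul, ← Complex.ofReal_neg,
      ← Complex.ofReal_exp, Complex.norm_real, Real.norm_eq_abs, Real.abs_exp]
    gcongr
    · exact le_of_lt hs
    · exact le_of_lt hy
  · refine Eventually.of_forall fun s y _ => ?_
    have h : HasDerivAt (fun y : ℝ => (Complex.I - (s : ℂ)) * (y : ℂ)) (Complex.I - s) y := by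
      simpa using (Complex.ofRealCLM.hasDerivAt (x := y)).const_mul (Complex.I - (s : ℂ))
    convert! h.cexp.mul_const (w s) using 1
    ring

theorem contDiffOn_outgoingLaplace (n : ℕ) {w : ℝ → ℂ} (hw : LaplaceIntegrable w) :
    ContDiffOn ℝ n (outgoingLaplace w) (Ioi 0) := by
  induction n generalizing w with
  | zero =>
    exact contDiffOn_zero.2 fun x hx =>
      (hasDerivAt_outgoingLaplace hw hx).continuousAt.continuousWithinAt
  | succ n ih =>
    have : ((n + 1 : ℕ) : WithTop ℕ∞) = (n : WithTop ℕ∞) + 1 := by norm_cast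
    rw [this, contDiffOn_succ_iff_deriv_of_isOpen isOpen_Ioi]
    refine ⟨fun x hx => (hasDerivAt_outgoingLaplace hw hx).differentiableAt.differentiableWithinAt,
      by simp, (ih hw.I_sub_mul).congr fun x hx => (hasDerivAt_outgoingLaplace hw hx).deriv⟩

/-! ### The density of K₀ on the imaginary axis. -/

/-- The symbol `s² - 2is` of the integral representation of `K₀` on the imaginary axis. -/
def macdonaldSymbol (s : ℝ) : ℂ := (s : ℂ) ^ 2 - 2 * Complex.I * s

/-- The Laplace density `(s² - 2is)^{-1/2}` of `x ↦ K₀(-ix)`. -/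
def macdonaldDensity (s : ℝ) : ℂ := macdonaldSymbol s ^ (-(1 / 2) : ℂ)

/-- The imaginary part -2s does not vanish, so the principal power is smooth along s > 0. -/
theorem macdonaldSymbol_mem_slitPlane {s : ℝ} (hs : 0 < s) :
    macdonaldSymbol s ∈ Complex.slitPlane := by
  refine Or.inr ?_
  simp [macdonaldSymbol, pow_two, hs.ne']

theorem macdonaldDensity_sq (s : ℝ) :
    macdonaldDensity s ^ 2 = (macdonaldSymbol s)⁻¹ := by
  rw [macdonaldDensity, ← Complex.cpow_nat_mul]
  norm_num
  rw [Complex.cpow_neg_one]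

/-- Norms are computed through the square, where the complex power disappears: |s² - 2is| = s |s -
2i|. -/
theorem norm_macdonaldDensity_sq {s : ℝ} (hs : 0 < s) :
    ‖macdonaldDensity s‖ ^ 2 = (s * √(s ^ 2 + 4))⁻¹ := by
  rw [← norm_pow, macdonaldDensity_sq s, norm_inv]
  have : macdonaldSymbol s = s * (s + (-2 : ℝ) * Complex.I) := by
    simp [macdonaldSymbol]; ring
  rw [this, norm_mul, Complex.norm_add_mul_I, Complex.norm_real, Real.norm_eq_abs, abs_of_pos hs]
  norm_num

/-- From √(s² + 4) ≥ 1; the bound is integrable at 0 and controls K₀ itself. -/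
theorem norm_macdonaldDensity_le_rpow {s : ℝ} (hs : 0 < s) :
    ‖macdonaldDensity s‖ ≤ s ^ (-(1 / 2) : ℝ) := by
  have h0 : 0 ≤ s ^ (-(1 / 2) : ℝ) := by positivity
  refine abs_le_of_sq_le_sq' ?_ h0 |>.2
  rw [norm_macdonaldDensity_sq hs, ← Real.rpow_mul_natCast hs.le]
  norm_num
  rw [Real.rpow_neg_one, ← mul_inv]
  have : (1 : ℝ) ≤ √(s ^ 2 + 4) := Real.one_le_sqrt.2 (by nlinarith)
  gcongr
  nlinarith

/-- From √(s² + 4) ≥ s; this bound controls K₀' - iK₀, whose density carries an extra factor s. -/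
theorem norm_mul_macdonaldDensity_le_one {s : ℝ} (hs : 0 < s) :
    ‖(s : ℂ) * macdonaldDensity s‖ ≤ 1 := by
  refine abs_le_of_sq_le_sq' ?_ zero_le_one |>.2
  rw [norm_mul, mul_pow, norm_macdonaldDensity_sq hs, Complex.norm_real, Real.norm_eq_abs, sq_abs]
  have : s ≤ √(s ^ 2 + 4) := Real.le_sqrt_of_sq_le (by linarith)
  rw [← div_eq_mul_inv, one_pow, div_le_one (by positivity)]
  nlinarith

theorem hasDerivAt_macdonaldSymbol (s : ℝ) :
    HasDerivAt macdonaldSymbol (2 * (s - Complex.I)) s := by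
  have h : HasDerivAt (fun s : ℝ => (s : ℂ)) 1 s := by
    simpa using (hasDerivAt_id s).ofReal_comp
  have := (h.pow 2).sub (h.const_mul (2 * Complex.I))
  refine this.congr_deriv ?_
  simp; ring

theorem continuousOn_macdonaldDensity : ContinuousOn macdonaldDensity (Ioi 0) := fun s hs =>
  ((hasDerivAt_macdonaldSymbol s).continuousAt.cpow continuousAt_const
    (macdonaldSymbol_mem_slitPlane hs)).continuousWithinAt

theorem laplaceIntegrable_macdonaldDensity : LaplaceIntegrable macdonaldDensity := by
  intro y hy
  have h := integrableOn_rpow_mul_exp_neg_mul_rpow (p := 1) (s := -(1 / 2)) (b := y)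
    (by norm_num) one_pos hy
  refine h.mono' ((by fun_prop : Continuous _).aestronglyMeasurable.mul
    (continuousOn_macdonaldDensity.aestronglyMeasurable measurableSet_Ioi)) ?_
  filter_upwards [ae_restrict_mem measurableSet_Ioi] with s hs
  rw [norm_mul, ← Complex.ofReal_neg, ← Complex.ofReal_exp, Complex.norm_real, Real.norm_eq_abs,
    Real.abs_exp, Real.rpow_one, mul_comm, neg_mul]
  gcongr
  exact norm_macdonaldDensity_le_rpow hs

/-! ### The outgoing profile: Bessel's equation, behaviour at infinity and at 0. -/

/-- The outgoing radial profile `x ↦ K₀(-ix)`. -/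
def outgoingProfile (x : ℝ) : ℂ := besselK0 (-Complex.I * x)

/-- The substitution t = xs; its Jacobian x cancels the factor 1/x that leaves the square root. -/
theorem outgoingProfile_eq {x : ℝ} (hx : 0 < x) :
    outgoingProfile x = outgoingLaplace macdonaldDensity x := by
  have hx' : (x : ℂ) ≠ 0 := by exact_mod_cast hx.ne'
  have hb := integral_comp_mul_left_Ioi' (fun t : ℝ => Complex.exp (-(t : ℂ)) *
    ((t : ℂ) ^ 2 + 2 * (-Complex.I * x) * t) ^ (-(1 / 2) : ℂ)) 0 hx
  rw [mul_zero] at hb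
  rw [outgoingProfile, besselK0, outgoingLaplace, ← hb, ← integral_smul, ← integral_const_mul]
  refine setIntegral_congr_fun measurableSet_Ioi fun s hs => ?_
  have hne := Complex.slitPlane_ne_zero (macdonaldSymbol_mem_slitPlane hs)
  have h1 : (((x * s : ℝ) : ℂ) ^ 2 + 2 * (-Complex.I * x) * (x * s : ℝ))
      = ((x ^ 2 : ℝ) : ℂ) * macdonaldSymbol s := by
    simp [macdonaldSymbol]; ring
  -- A positive factor only adds a real number to the principal logarithm, so the power splits
  -- without a branch change.
  have h2 : (((x ^ 2 : ℝ) : ℂ) * macdonaldSymbol s) ^ (-(1 / 2) : ℂ)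
      = (x : ℂ)⁻¹ * macdonaldDensity s := by
    have hx2 : ((x ^ 2 : ℝ) : ℂ) ≠ 0 := by exact_mod_cast (by positivity : x ^ 2 ≠ 0)
    rw [macdonaldDensity, Complex.cpow_def_of_ne_zero (mul_ne_zero hx2 hne),
      Complex.cpow_def_of_ne_zero hne, Complex.log_ofReal_mul (by positivity) hne, add_mul,
      Complex.exp_add]
    congr 1
    rw [Real.log_pow, show ((((2 : ℕ) : ℝ) * Real.log x : ℝ) : ℂ) * (-(1 / 2))
      = -((Real.log x : ℝ) : ℂ) by push_cast; ring, Complex.exp_neg, ← Complex.ofReal_exp,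
      Real.exp_log hx]
  simp only [h1, h2, Complex.real_smul]
  rw [show (Complex.I - (s : ℂ)) * x = -(-Complex.I * x) + -((x * s : ℝ) : ℂ) by push_cast; ring,
    Complex.exp_add]
  field_simp

/-- The derivative of the outgoing profile on `(0, ∞)`. -/
def outgoingProfileDeriv (x : ℝ) : ℂ :=
  outgoingLaplace (fun s => (Complex.I - s) * macdonaldDensity s) x

theorem hasDerivAt_outgoingProfile {x : ℝ} (hx : 0 < x) :
    HasDerivAt outgoingProfile (outgoingProfileDeriv x) x :=
  (hasDerivAt_outgoingLaplace laplaceIntegrable_macdonaldDensity hx).congr_of_eventuallyEq <| by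
    filter_upwards [Ioi_mem_nhds hx] with y hy using outgoingProfile_eq hy

theorem contDiffAt_outgoingProfile {x : ℝ} (hx : 0 < x) : ContDiffAt ℝ 2 outgoingProfile x :=
  ((contDiffOn_outgoingLaplace 2 laplaceIntegrable_macdonaldDensity).contDiffAt
    (Ioi_mem_nhds hx)).congr_of_eventuallyEq <| by
    filter_upwards [Ioi_mem_nhds hx] with y hy using outgoingProfile_eq hy

/-- The Bessel equation `x K'' + K' + x K = 0` in integral form. -/
theorem outgoingLaplace_bessel {x : ℝ} (hx : 0 < x) :
    x * outgoingLaplace (fun s => (Complex.I - s) * ((Complex.I - s) * macdonaldDensity s)) x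
      + outgoingProfileDeriv x + x * outgoingProfile x = 0 := by
  have hg := laplaceIntegrable_macdonaldDensity
  have i0 := (hg.integrableOn_exp hx).const_mul (x : ℂ)
  have i1 := hg.I_sub_mul.integrableOn_exp hx
  have i2 := (hg.I_sub_mul.I_sub_mul.integrableOn_exp hx).const_mul (x : ℂ)
  rw [outgoingProfile_eq hx, outgoingProfileDeriv, outgoingLaplace, outgoingLaplace,
    outgoingLaplace, ← integral_const_mul, ← integral_const_mul, ← integral_add i2 i1]
  refine (integral_add (i2.add i1) i0).symm.trans ?_
  -- With q = s² - 2is = (i - s)² + 1, the summed integrand e^{(i-s)x} (xq + i - s) q^{-1/2} is the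
  -- derivative of -e^{(i-s)x} q^{1/2}, which vanishes at both ends. The square root is written q ·
  -- q^{-1/2} to reuse the density.
  have key := integral_Ioi_of_hasDerivAt_of_tendsto_of_tendsto (a := 0) (m := 0) (n := 0)
    (f := fun s : ℝ => -(Complex.exp ((Complex.I - s) * x) *
      (macdonaldSymbol s * macdonaldDensity s)))
    (f' := fun s : ℝ => x * (Complex.exp ((Complex.I - s) * x) *
      ((Complex.I - s) * ((Complex.I - s) * macdonaldDensity s)))
      + Complex.exp ((Complex.I - s) * x) * ((Complex.I - s) * macdonaldDensity s)
      + x * (Complex.exp ((Complex.I - s) * x) * macdonaldDensity s)) ?_ ((i2.add i1).add i0) ?_ ?_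
  · exact key.trans (sub_zero 0)
  · intro s hs
    have hs : 0 < s := hs
    have hq := macdonaldSymbol_mem_slitPlane hs
    have hne := Complex.slitPlane_ne_zero hq
    have h1 : HasDerivAt (fun s : ℝ => macdonaldSymbol s * macdonaldDensity s)
        ((s - Complex.I) * macdonaldDensity s) s := by
      have h2 := (hasDerivAt_macdonaldSymbol s)
      have h3 : HasDerivAt macdonaldDensity _ s :=
        ((hasDerivAt_id (macdonaldSymbol s)).cpow_const (c := -(1 / 2)) hq).scomp s h2
      refine (h2.mul h3).congr_deriv ?_
      simp only [smul_eq_mul, id]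
      rw [Complex.cpow_sub _ _ hne, Complex.cpow_one, ← macdonaldDensity]
      field_simp
      ring
    have h4 : HasDerivAt (fun s : ℝ => (Complex.I - (s : ℂ)) * (x : ℂ)) (-x) s := by
      simpa using (((Complex.ofRealCLM.hasDerivAt (x := s)).const_sub Complex.I).mul_const (x : ℂ))
    refine (h4.cexp.mul h1).neg.congr_deriv ?_
    have hsym : macdonaldSymbol s = (Complex.I - s) ^ 2 + 1 := by
      simp only [macdonaldSymbol]; ring_nf; simp; ring
    rw [hsym]; ring
  -- At 0 the majorant |q| s^{-1/2} equals s^{1/2} √(s² + 4).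
  · refine squeeze_zero_norm' (a := fun s : ℝ => ‖macdonaldSymbol s‖ * (s ^ (-(1 / 2) : ℝ))) ?_ ?_
    · filter_upwards [self_mem_nhdsWithin] with s hs
      have hs : 0 < s := hs
      rw [norm_neg, norm_mul, norm_mul, norm_exp_I_sub_mul]
      have h1 : Real.exp (-(x * s)) ≤ 1 := Real.exp_le_one_iff.2 (by nlinarith)
      have h2 := norm_macdonaldDensity_le_rpow hs
      calc _ ≤ 1 * (‖macdonaldSymbol s‖ * s ^ (-(1 / 2) : ℝ)) := by gcongr
        _ = _ := one_mul _
    · have h : Tendsto (fun s : ℝ => √(s ^ 2 + 4) * s ^ (1 / 2 : ℝ)) (𝓝[>] 0) (𝓝 0) := by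
        have : ContinuousAt (fun s : ℝ => √(s ^ 2 + 4) * s ^ (1 / 2 : ℝ)) 0 := by
          refine ContinuousAt.mul (by fun_prop) ?_
          exact Real.continuousAt_rpow_const _ _ (Or.inr (by norm_num))
        have := this.tendsto
        simp only [one_div] at this ⊢
        rw [Real.zero_rpow (by norm_num), mul_zero] at this
        exact this.mono_left nhdsWithin_le_nhds
      refine h.congr' ?_
      filter_upwards [self_mem_nhdsWithin] with s hs
      have hs : 0 < s := hs
      have : ‖macdonaldSymbol s‖ = s * √(s ^ 2 + 4) := by
        rw [← inv_inj, ← norm_inv, ← macdonaldDensity_sq s, norm_pow, norm_macdonaldDensity_sq hs]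
      rw [this, show (1 / 2 : ℝ) = 1 + -(1 / 2) by norm_num, Real.rpow_add hs, Real.rpow_one]
      ring_nf
  · refine squeeze_zero_norm' (a := fun s : ℝ => Real.exp (-(x * s)) * (s + 2)) ?_ ?_
    · filter_upwards [Ioi_mem_atTop 0] with s hs
      have hs : 0 < s := hs
      rw [norm_neg, norm_mul, norm_exp_I_sub_mul]
      gcongr
      have : macdonaldSymbol s * macdonaldDensity s
          = (s - 2 * Complex.I) * (s * macdonaldDensity s) := by
        simp only [macdonaldSymbol]; ring
      rw [this, norm_mul]
      have h1 := norm_mul_macdonaldDensity_le_one hs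
      have h2 : ‖(s : ℂ) - 2 * Complex.I‖ ≤ s + 2 := by
        refine (norm_sub_le _ _).trans ?_
        simp [abs_of_pos hs]
      calc _ ≤ (s + 2) * 1 := by gcongr
        _ = _ := mul_one _
    · have h1 := Real.tendsto_pow_mul_exp_neg_atTop_nhds_zero 1
      have h0 := Real.tendsto_pow_mul_exp_neg_atTop_nhds_zero 0
      have hx1 : Tendsto (fun s : ℝ => x * s) atTop atTop := tendsto_id.const_mul_atTop hx
      have := ((h1.comp hx1).const_mul x⁻¹).add ((h0.comp hx1).const_mul 2)
      simp only [mul_zero, add_zero] at this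
      refine this.congr fun s => ?_
      simp only [Function.comp]
      field_simp

/-- The second derivative of the outgoing profile, from the Bessel equation. -/
theorem hasDerivAt_outgoingProfileDeriv {x : ℝ} (hx : 0 < x) :
    HasDerivAt outgoingProfileDeriv (-outgoingProfileDeriv x / x - outgoingProfile x) x := by
  refine (hasDerivAt_outgoingLaplace laplaceIntegrable_macdonaldDensity.I_sub_mul hx).congr_deriv ?_
  have hx' : (x : ℂ) ≠ 0 := by exact_mod_cast hx.ne'
  rw [eq_sub_iff_add_eq, eq_div_iff hx']
  linear_combination outgoingLaplace_bessel hx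

/-- The i in the factor i - s cancels and leaves the bounded density s w. Both the radiation
estimate and the limit of x K' at 0 start here. -/
theorem outgoingProfileDeriv_sub {x : ℝ} (hx : 0 < x) :
    outgoingProfileDeriv x - Complex.I * outgoingProfile x
      = -outgoingLaplace (fun s => s * macdonaldDensity s) x := by
  have hg := laplaceIntegrable_macdonaldDensity
  rw [outgoingProfile_eq hx, outgoingProfileDeriv, outgoingLaplace, outgoingLaplace,
    outgoingLaplace, ← integral_const_mul, ← integral_neg,
    ← integral_sub (hg.I_sub_mul.integrableOn_exp hx) ((hg.integrableOn_exp hx).const_mul _)]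
  congr 1 with s
  ring

theorem integrableOn_exp_neg_mul {x : ℝ} (hx : 0 < x) :
    IntegrableOn (fun s : ℝ => Real.exp (-(x * s))) (Ioi 0) := by
  simpa [neg_mul] using exp_neg_integrableOn_Ioi 0 hx

/-- The profile is outgoing: `K' - iK` decays like `1 / x`. -/
theorem norm_outgoingProfileDeriv_sub_le {x : ℝ} (hx : 0 < x) :
    ‖outgoingProfileDeriv x - Complex.I * outgoingProfile x‖ ≤ x⁻¹ := by
  rw [outgoingProfileDeriv_sub hx, norm_neg, outgoingLaplace]
  have h : ∫ s in Ioi (0 : ℝ), Real.exp (-(x * s)) = x⁻¹ := by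
    have := integral_exp_mul_Ioi (a := -x) (by linarith) 0
    simp only [neg_mul] at this
    rw [this]; simp
  rw [← h]
  refine norm_integral_le_of_norm_le (integrableOn_exp_neg_mul hx) ?_
  filter_upwards [ae_restrict_mem measurableSet_Ioi] with s hs
  rw [norm_mul, norm_exp_I_sub_mul]
  calc _ ≤ Real.exp (-(x * s)) * 1 := by
        gcongr; exact norm_mul_macdonaldDensity_le_one hs
    _ = _ := mul_one _

/-- The bound |w| ≤ s^{-1/2} leaves a Gamma integral. Near 0 it is cruder than the logarithm, but
enough for local integrability and for x K → 0. -/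
theorem norm_outgoingProfile_le {x : ℝ} (hx : 0 < x) :
    ‖outgoingProfile x‖ ≤ Real.Gamma (1 / 2) * x ^ (-(1 / 2) : ℝ) := by
  have h := Real.integral_rpow_mul_exp_neg_mul_Ioi (a := 1 / 2) (by norm_num) hx
  have h2 : Real.Gamma (1 / 2) * x ^ (-(1 / 2) : ℝ)
      = ∫ t in Ioi 0, t ^ ((1 / 2 : ℝ) - 1) * Real.exp (-(x * t)) := by
    rw [h, one_div x, Real.inv_rpow hx.le, Real.rpow_neg hx.le, mul_comm]
  rw [outgoingProfile_eq hx, h2, outgoingLaplace]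
  have hi := integrableOn_rpow_mul_exp_neg_mul_rpow (p := 1) (s := 1 / 2 - 1) (b := x)
    (by norm_num) one_pos hx
  simp only [Real.rpow_one, neg_mul] at hi
  refine norm_integral_le_of_norm_le hi ?_
  filter_upwards [ae_restrict_mem measurableSet_Ioi] with s hs
  rw [norm_mul, norm_exp_I_sub_mul, mul_comm]
  gcongr
  rw [show (1 / 2 : ℝ) - 1 = -(1 / 2) by norm_num]
  exact norm_macdonaldDensity_le_rpow hs

theorem tendsto_mul_outgoingProfile :
    Tendsto (fun x : ℝ => (x : ℂ) * outgoingProfile x) (𝓝[>] 0) (𝓝 0) := by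
  refine squeeze_zero_norm' (a := fun x : ℝ => Real.Gamma (1 / 2) * x ^ (1 / 2 : ℝ)) ?_ ?_
  · filter_upwards [self_mem_nhdsWithin] with x hx
    have hx : 0 < x := hx
    rw [norm_mul, Complex.norm_real, Real.norm_eq_abs, abs_of_pos hx]
    calc x * ‖outgoingProfile x‖ ≤ x * (Real.Gamma (1 / 2) * x ^ (-(1 / 2) : ℝ)) := by
          gcongr; exact norm_outgoingProfile_le hx
      _ = Real.Gamma (1 / 2) * x ^ (1 / 2 : ℝ) := by
          have : x ^ (1 / 2 : ℝ) = x * x ^ (-(1 / 2) : ℝ) := by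
            rw [← Real.rpow_one_add' hx.le (by norm_num)]; norm_num
          rw [this]; ring
  · have : ContinuousAt (fun s : ℝ => Real.Gamma (1 / 2) * s ^ (1 / 2 : ℝ)) 0 :=
      continuousAt_const.mul (Real.continuousAt_rpow_const _ _ (Or.inr (by norm_num)))
    have := this.tendsto
    rw [Real.zero_rpow (by norm_num), mul_zero] at this
    exact this.mono_left nhdsWithin_le_nhds

/-- For s > 0 the product is (1 - 2i/s)^{-1/2}. -/
theorem tendsto_mul_macdonaldDensity :
    Tendsto (fun s : ℝ => (s : ℂ) * macdonaldDensity s) atTop (𝓝 1) := by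
  have h1 : Tendsto (fun s : ℝ => (1 - 2 * Complex.I * ((s⁻¹ : ℝ) : ℂ)) ^ (-(1 / 2) : ℂ))
      atTop (𝓝 1) := by
    have h2 : Tendsto (fun s : ℝ => (1 - 2 * Complex.I * ((s⁻¹ : ℝ) : ℂ))) atTop (𝓝 1) := by
      have := (Complex.continuous_ofReal.tendsto 0).comp tendsto_inv_atTop_zero
      simpa using (this.const_mul (2 * Complex.I)).const_sub 1
    have := h2.cpow (tendsto_const_nhds (x := (-(1 / 2) : ℂ))) (by simp)
    simpa using this
  refine h1.congr' ?_
  filter_upwards [Ioi_mem_atTop 0] with s hs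
  have hs : 0 < s := hs
  have hs' : (s : ℂ) ≠ 0 := by exact_mod_cast hs.ne'
  have hs2 : ((s ^ 2 : ℝ) : ℂ) ≠ 0 := by exact_mod_cast (by positivity : s ^ 2 ≠ 0)
  have hsym : macdonaldSymbol s = ((s ^ 2 : ℝ) : ℂ) * (1 - 2 * Complex.I * ((s⁻¹ : ℝ) : ℂ)) := by
    simp only [macdonaldSymbol]; push_cast; field_simp
  have hne : (1 - 2 * Complex.I * ((s⁻¹ : ℝ) : ℂ)) ≠ 0 := by
    intro h
    have := Complex.slitPlane_ne_zero (macdonaldSymbol_mem_slitPlane hs)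
    rw [hsym, h, mul_zero] at this
    exact this rfl
  rw [macdonaldDensity, hsym, Complex.cpow_def_of_ne_zero (mul_ne_zero hs2 hne),
    Complex.cpow_def_of_ne_zero hne, Complex.log_ofReal_mul (by positivity) hne, add_mul,
    Complex.exp_add, Real.log_pow, show ((((2 : ℕ) : ℝ) * Real.log s : ℝ) : ℂ) * (-(1 / 2))
      = -((Real.log s : ℝ) : ℂ) by push_cast; ring, Complex.exp_neg, ← Complex.ofReal_exp,
      Real.exp_log hs]
  field_simp

/-- The logarithmic singularity of `K₀`, in the form `x K'(x) → -1`. -/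
theorem tendsto_mul_outgoingProfileDeriv :
    Tendsto (fun x : ℝ => (x : ℂ) * outgoingProfileDeriv x) (𝓝[>] 0) (𝓝 (-1)) := by
  -- The rescaling u = xs of x ∫ e^{(i-s)x} s w ds. The integrand is dominated by e^{-u} and tends
  -- to e^{-u}, so the integral tends to 1; the other part of x K', namely i x K, tends to 0.
  have h : Tendsto (fun x : ℝ => ∫ u in Ioi (0 : ℝ), Complex.exp (Complex.I * x - u) *
      (((u / x : ℝ) : ℂ) * macdonaldDensity (u / x))) (𝓝[>] 0)
      (𝓝 (∫ u in Ioi (0 : ℝ), Complex.exp (-(u : ℂ)))) := by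
    refine tendsto_integral_filter_of_dominated_convergence (fun u => Real.exp (-(1 * u)))
      ?_ ?_ (integrableOn_exp_neg_mul one_pos) ?_
    · filter_upwards [self_mem_nhdsWithin] with x hx
      have hx : 0 < x := hx
      refine (by fun_prop : Continuous _).aestronglyMeasurable.mul
        ((by fun_prop : Continuous _).aestronglyMeasurable.mul ?_)
      refine (continuousOn_macdonaldDensity.comp (by fun_prop) ?_).aestronglyMeasurable
        measurableSet_Ioi
      exact fun u hu => div_pos hu hx
    · filter_upwards [self_mem_nhdsWithin] with x hx
      have hx : 0 < x := hx
      filter_upwards [ae_restrict_mem measurableSet_Ioi] with u hu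
      rw [norm_mul, Complex.norm_exp]
      have : (Complex.I * x - u).re = -(1 * u) := by simp
      rw [this]
      calc _ ≤ Real.exp (-(1 * u)) * 1 := by
            gcongr; exact norm_mul_macdonaldDensity_le_one (div_pos hu hx)
        _ = _ := mul_one _
    · filter_upwards [ae_restrict_mem measurableSet_Ioi] with u hu
      have hu : 0 < u := hu
      have h1 : Tendsto (fun x : ℝ => u / x) (𝓝[>] 0) atTop :=
        tendsto_inv_nhdsGT_zero.const_mul_atTop hu
      have h2 := tendsto_mul_macdonaldDensity.comp h1
      have h3 : Tendsto (fun x : ℝ => Complex.exp (Complex.I * x - u)) (𝓝[>] 0)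
          (𝓝 (Complex.exp (-(u : ℂ)))) := by
        have : Continuous (fun x : ℝ => Complex.exp (Complex.I * x - u)) := by fun_prop
        simpa using (this.tendsto 0).mono_left nhdsWithin_le_nhds
      simpa [Function.comp_def] using h3.mul h2
  have hone : ∫ u in Ioi (0 : ℝ), Complex.exp (-(u : ℂ)) = 1 := by
    have := integral_exp_neg_Ioi_zero
    rw [← Complex.ofReal_inj, ← integral_complex_ofReal] at this
    simpa using this
  rw [hone] at h
  have h5 := (tendsto_mul_outgoingProfile.const_mul Complex.I).sub h
  rw [mul_zero, zero_sub] at h5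
  refine h5.congr' ?_
  filter_upwards [self_mem_nhdsWithin] with x hx
  have hx : 0 < x := hx
  have h6 := integral_comp_mul_left_Ioi' (fun u : ℝ => Complex.exp (Complex.I * x - u) *
      (((u / x : ℝ) : ℂ) * macdonaldDensity (u / x))) 0 hx
  rw [mul_zero] at h6
  have h7 : ∫ s in Ioi (0 : ℝ), Complex.exp (Complex.I * x - (x * s : ℝ)) *
      (((x * s / x : ℝ) : ℂ) * macdonaldDensity (x * s / x))
      = outgoingLaplace (fun s => s * macdonaldDensity s) x := by
    rw [outgoingLaplace]
    congr 1 with s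
    rw [mul_div_cancel_left₀ s hx.ne']
    congr 2
    push_cast; ring
  rw [← h6, h7, Complex.real_smul]
  linear_combination (-(x : ℂ)) * (outgoingProfileDeriv_sub hx)

/-! ### The cylindrical wave and the Helmholtz equation away from its source. -/

/-- The outgoing cylindrical wave `x ↦ K₀(-i κ |x - p|)` with source `p`. -/
def outgoingField (κ : ℝ) (p x : Plane) : ℂ := outgoingProfile (κ * ‖x - p‖)

/-- The gradient is (x - p) times g'/r, which is again a radial coefficient; the lemma can thus be
applied a second time to obtain second derivatives. -/
theorem hasFDerivAt_radial {g : ℝ → ℂ} {g' : ℂ} {p x : Plane} (hx : x ≠ p)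
    (hg : HasDerivAt g g' ‖x - p‖) :
    HasFDerivAt (fun y : Plane => g ‖y - p‖)
      ((innerSL ℝ (x - p)).smulRight (g' / (‖x - p‖ : ℂ))) x := by
  have hr : ‖x - p‖ ≠ 0 := norm_ne_zero_iff.2 (sub_ne_zero.2 hx)
  have h1 : HasFDerivAt (fun y : Plane => y - p) (ContinuousLinearMap.id ℝ Plane) x :=
    (hasFDerivAt_id x).sub_const p
  have h2 := h1.norm_sq.sqrt (pow_ne_zero 2 hr)
  simp only [Real.sqrt_sq (norm_nonneg _)] at h2
  have h3 := HasFDerivAt.comp x hg.hasFDerivAt h2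
  refine h3.congr_fderiv ?_
  ext v
  have hr' : (‖x - p‖ : ℂ) ≠ 0 := by exact_mod_cast hr
  simp
  field_simp

theorem contDiffAt_outgoingField {κ : ℝ} (hκ : 0 < κ) {p x : Plane} (hx : x ≠ p) :
    ContDiffAt ℝ 2 (outgoingField κ p) x := by
  have hr : 0 < ‖x - p‖ := norm_pos_iff.2 (sub_ne_zero.2 hx)
  have h1 : ContDiffAt ℝ 2 (fun y : Plane => κ * ‖y - p‖) x :=
    contDiffAt_const.mul ((contDiffAt_id.sub contDiffAt_const).norm ℝ (sub_ne_zero.2 hx))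
  exact (contDiffAt_outgoingProfile (mul_pos hκ hr)).comp x h1

theorem hasDerivAt_outgoingProfile_mul {κ r : ℝ} (hκ : 0 < κ) (hr : 0 < r) :
    HasDerivAt (fun r : ℝ => outgoingProfile (κ * r)) (κ * outgoingProfileDeriv (κ * r)) r := by
  have := (hasDerivAt_outgoingProfile (mul_pos hκ hr)).scomp r
    ((hasDerivAt_id r).const_mul κ)
  refine this.congr_deriv ?_
  simp

theorem hasDerivAt_outgoingProfileDeriv_mul {κ r : ℝ} (hκ : 0 < κ) (hr : 0 < r) :
    HasDerivAt (fun r : ℝ => outgoingProfileDeriv (κ * r))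
      (-outgoingProfileDeriv (κ * r) / r - κ * outgoingProfile (κ * r)) r := by
  have := (hasDerivAt_outgoingProfileDeriv (mul_pos hκ hr)).scomp r
    ((hasDerivAt_id r).const_mul κ)
  refine this.congr_deriv ?_
  have h1 : (κ : ℂ) ≠ 0 := by exact_mod_cast hκ.ne'
  have h2 : (r : ℂ) ≠ 0 := by exact_mod_cast hr.ne'
  simp
  field_simp

theorem hasFDerivAt_outgoingField {κ : ℝ} (hκ : 0 < κ) {p x : Plane} (hx : x ≠ p) :
    HasFDerivAt (outgoingField κ p) ((innerSL ℝ (x - p)).smulRight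
      (κ * outgoingProfileDeriv (κ * ‖x - p‖) / (‖x - p‖ : ℂ))) x :=
  hasFDerivAt_radial hx
    (hasDerivAt_outgoingProfile_mul hκ (norm_pos_iff.2 (sub_ne_zero.2 hx)))

theorem iteratedFDeriv_two_line {f : Plane → ℂ} {x v : Plane} {D : Plane →L[ℝ] ℂ}
    (hf : ContDiffAt ℝ 2 f x) (hD : HasFDerivAt (fun y => fderiv ℝ f y v) D x) :
    iteratedFDeriv ℝ 2 f x ![v, v] = D v := by
  have h1 : DifferentiableAt ℝ (fderiv ℝ f) x :=
    (hf.fderiv_right (m := 1) (by norm_num)).differentiableAt one_ne_zero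
  have h2 := (h1.hasFDerivAt.clm_apply (hasFDerivAt_const v x)).unique hD
  rw [iteratedFDeriv_two_apply, ← h2]
  simp

theorem plane_norm_sq (x : Plane) : ‖x‖ ^ 2 = x 0 ^ 2 + x 1 ^ 2 := by
  rw [EuclideanSpace.norm_sq_eq, Fin.sum_univ_two]
  simp

/-- The Helmholtz equation for the outgoing field, away from its source. -/
theorem laplacian_outgoingField {κ : ℝ} (hκ : 0 < κ) {p x : Plane} (hx : x ≠ p) :
    (Δ (outgoingField κ p)) x = -κ ^ 2 * outgoingField κ p x := by
  have hr : 0 < ‖x - p‖ := norm_pos_iff.2 (sub_ne_zero.2 hx)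
  set r := ‖x - p‖ with hrdef
  have hr' : (r : ℂ) ≠ 0 := by exact_mod_cast hr.ne'
  -- For the radial function f(r) = K₀(-iκr) the gradient is g(r)(x - p) with g = f'/r, so ∂ᵢ²f = (x
  -- - p)ᵢ² g'/r + g. Summing gives r g' + 2g = f'' + f'/r, which Bessel's equation, already built
  -- into g', turns into -κ²f.
  set g : ℝ → ℂ := fun s => κ * outgoingProfileDeriv (κ * s) / (s : ℂ) with hg
  set g' : ℂ := (κ * (-outgoingProfileDeriv (κ * r) / r - κ * outgoingProfile (κ * r)) * r
    - κ * outgoingProfileDeriv (κ * r)) / r ^ 2 with hg'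
  have hgd : HasDerivAt g g' r := by
    have h1 := (hasDerivAt_outgoingProfileDeriv_mul hκ hr).const_mul (κ : ℂ)
    have h2 : HasDerivAt (fun s : ℝ => (s : ℂ)) 1 r := by
      simpa using (hasDerivAt_id r).ofReal_comp
    refine (h1.div h2 hr').congr_deriv ?_
    simp [hg']
  have key : ∀ i : Fin 2, iteratedFDeriv ℝ 2 (outgoingField κ p) x ![unitVec i, unitVec i]
      = ((x - p) i : ℂ) ^ 2 * (g' / r) + g r := by
    intro i
    have hD : HasFDerivAt (fun y => fderiv ℝ (outgoingField κ p) y (unitVec i))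
        ((((x - p) i : ℝ) • (innerSL ℝ (x - p)).smulRight (g' / (r : ℂ)))
          + ((innerSL ℝ (unitVec i)).smulRight (g r))) x := by
      have h1 : HasFDerivAt (fun y : Plane => innerSL ℝ (unitVec i) (y - p))
          (innerSL ℝ (unitVec i)) x := by
        simp_rw [map_sub]
        exact (innerSL ℝ (unitVec i)).hasFDerivAt.sub_const _
      have h2 := h1.smul (hasFDerivAt_radial hx hgd)
      have h3 : innerSL ℝ (unitVec i) (x - p) = (x - p) i := by
        simp [unitVec, EuclideanSpace.inner_single_left]
      rw [h3] at h2
      refine h2.congr_of_eventuallyEq ?_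
      filter_upwards [isOpen_ne.mem_nhds hx] with y hy
      rw [(hasFDerivAt_outgoingField hκ hy).fderiv]
      simp only [ContinuousLinearMap.smulRight_apply, Pi.smul_apply', innerSL_apply_apply, hg]
      rw [real_inner_comm]
    rw [iteratedFDeriv_two_line (contDiffAt_outgoingField hκ hx) hD]
    simp [unitVec, EuclideanSpace.inner_single_right]
    ring
  rw [InnerProductSpace.laplacian_eq_iteratedFDeriv_orthonormalBasis _
    (EuclideanSpace.basisFun (Fin 2) ℝ)]
  simp only [Fin.sum_univ_two]
  have k0 := key 0
  have k1 := key 1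
  simp only [unitVec] at k0 k1
  simp only [EuclideanSpace.basisFun_apply]
  rw [k0, k1]
  have hsq : ((x - p) 0 : ℂ) ^ 2 + ((x - p) 1 : ℂ) ^ 2 = (r : ℂ) ^ 2 := by
    rw [hrdef]; exact_mod_cast (plane_norm_sq (x - p)).symm
  have : ∀ a b c d : ℂ, a * c + d + (b * c + d) = (a + b) * c + 2 * d := by intros; ring
  rw [this, hsq, hg', hg, outgoingField, ← hrdef]
  field_simp
  ring

/-! ### Integrability of the wave near its source. -/

theorem continuousOn_outgoingProfile_mul {κ : ℝ} (hκ : 0 < κ) :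
    ContinuousOn (fun r : ℝ => outgoingProfile (κ * r)) (Ioi 0) := fun _ hr =>
  (hasDerivAt_outgoingProfile_mul hκ hr).continuousAt.continuousWithinAt

theorem integrableOn_outgoingProfile_mul {κ : ℝ} (hκ : 0 < κ) {R : ℝ} (hR : 0 ≤ R) :
    IntegrableOn (fun r : ℝ => outgoingProfile (κ * r)) (Ioc 0 R) := by
  have h1 : IntegrableOn (fun r : ℝ => r ^ (-(1 / 2) : ℝ)) (Ioc 0 R) :=
    (intervalIntegrable_iff_integrableOn_Ioc_of_le hR).1
      (intervalIntegral.intervalIntegrable_rpow' (by norm_num))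
  refine (h1.const_mul (Real.Gamma (1 / 2) * κ ^ (-(1 / 2) : ℝ))).mono' ?_ ?_
  · exact ((continuousOn_outgoingProfile_mul hκ).mono fun _ h => h.1).aestronglyMeasurable
      measurableSet_Ioc
  · filter_upwards [ae_restrict_mem measurableSet_Ioc] with r hr
    refine (norm_outgoingProfile_le (mul_pos hκ hr.1)).trans (le_of_eq ?_)
    rw [Real.mul_rpow hκ.le hr.1.le, mul_assoc]

theorem integrableOn_outgoingProfile_mul_continuous {κ : ℝ} (hκ : 0 < κ) {R : ℝ} (hR : 0 ≤ R)
    {c : ℝ → ℂ} (hc : Continuous c) (hcR : ∀ r, R < r → c r = 0) :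
    IntegrableOn (fun r : ℝ => outgoingProfile (κ * r) * c r) (Ioi 0) := by
  refine IntegrableOn.of_forall_sdiff_eq_zero (s := Ioc 0 R) ?_ measurableSet_Ioi ?_
  · obtain ⟨M, hM⟩ := (isCompact_Icc (a := 0) (b := R)).exists_bound_of_continuousOn
      hc.continuousOn
    refine (integrableOn_outgoingProfile_mul hκ hR).mul_bdd (c := M) hc.aestronglyMeasurable ?_
    filter_upwards [ae_restrict_mem measurableSet_Ioc] with r hr
    exact hM r ⟨hr.1.le, hr.2⟩
  · rintro r ⟨hr0, hr⟩
    rw [hcR r, mul_zero]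
    by_contra h
    exact hr ⟨hr0, not_lt.1 h⟩

/-- The absolute integrability in (r, θ) that Fubini needs for the Green identity. -/
theorem integrableOn_outgoingProfile_mul_continuous_prod {κ : ℝ} (hκ : 0 < κ) {R : ℝ} (hR : 0 ≤ R)
    {c : ℝ × ℝ → ℂ} (hc : Continuous c) (hcR : ∀ r θ, R < r → c (r, θ) = 0) :
    IntegrableOn (fun q : ℝ × ℝ => outgoingProfile (κ * q.1) * c q)
      (Ioi 0 ×ˢ Ioo (-Real.pi) Real.pi) := by
  refine IntegrableOn.of_forall_sdiff_eq_zero (s := Ioc 0 R ×ˢ Ioo (-Real.pi) Real.pi) ?_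
    (measurableSet_Ioi.prod measurableSet_Ioo) ?_
  · obtain ⟨M, hM⟩ := ((isCompact_Icc (a := 0) (b := R)).prod
      (isCompact_Icc (a := -Real.pi) (b := Real.pi))).exists_bound_of_continuousOn hc.continuousOn
    have h1 : IntegrableOn (fun q : ℝ × ℝ => outgoingProfile (κ * q.1) * 1)
        (Ioc 0 R ×ˢ Ioo (-Real.pi) Real.pi) := by
      rw [IntegrableOn, Measure.volume_eq_prod, ← Measure.prod_restrict]
      exact (integrableOn_outgoingProfile_mul hκ hR).mul_prod (g := fun _ : ℝ => (1 : ℂ))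
        (integrable_const _)
    simp only [mul_one] at h1
    refine h1.mul_bdd (c := M) hc.aestronglyMeasurable ?_
    filter_upwards [ae_restrict_mem (measurableSet_Ioc.prod measurableSet_Ioo)] with q hq
    exact hM q ⟨⟨hq.1.1.le, hq.1.2⟩, Ioo_subset_Icc_self hq.2⟩
  · rintro ⟨r, θ⟩ ⟨hr0, hr⟩
    rw [hcR r, mul_zero]
    by_contra h
    exact hr ⟨⟨hr0.1, not_lt.1 h⟩, hr0.2⟩

theorem locallyIntegrable_outgoingField {κ : ℝ} (hκ : 0 < κ) (p : Plane) :
    LocallyIntegrable (outgoingField κ p) := by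
  have hball : ∀ R : ℝ, 0 ≤ R → IntegrableOn (outgoingField κ p) (Metric.closedBall p R) := by
    intro R hR
    have h1 : Integrable (fun x : Plane =>
        (Iic R).indicator (fun r => outgoingProfile (κ * r)) ‖x‖) := by
      rw [integrable_fun_norm_addHaar (E := Plane) volume
        (f := (Iic R).indicator (fun r => outgoingProfile (κ * r)))]
      refine IntegrableOn.of_forall_sdiff_eq_zero (s := Ioc 0 R) ?_ measurableSet_Ioi ?_
      · obtain ⟨M, hM⟩ := (isCompact_Icc (a := 0) (b := R)).exists_bound_of_continuousOn
          (f := fun r : ℝ => (r : ℂ)) (by fun_prop)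
        have := (integrableOn_outgoingProfile_mul hκ hR).mul_bdd (c := M)
          (g := fun r : ℝ => (r : ℂ)) (by fun_prop : Continuous _).aestronglyMeasurable (by
            filter_upwards [ae_restrict_mem measurableSet_Ioc] with r hr
            exact hM r ⟨hr.1.le, hr.2⟩)
        refine IntegrableOn.congr_fun this (fun r hr => ?_) measurableSet_Ioc
        simp [indicator_of_mem (show r ∈ Iic R from hr.2), mul_comm]
      · rintro r ⟨hr0, hr⟩
        have : r ∉ Iic R := fun h => hr ⟨hr0, h⟩
        simp [indicator_of_notMem this]
    have h2 := h1.comp_sub_right p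
    refine (h2.integrableOn (s := Metric.closedBall p R)).congr_fun (fun x hx => ?_)
      Metric.isClosed_closedBall.measurableSet
    have : ‖x - p‖ ∈ Iic R := by simpa [dist_eq_norm] using hx
    simp only [indicator_of_mem this]
    rfl
  refine locallyIntegrable_iff.2 fun K hK => ?_
  obtain ⟨R, hR⟩ := hK.isBounded.subset_closedBall p
  exact (hball (max R 0) (le_max_right _ _)).mono_set
    (hR.trans (Metric.closedBall_subset_closedBall (le_max_left _ _)))

/-! ### Polar coordinates and the moving frame. -/

/-- The unit radial vector at the polar angle `θ`. -/
def radialVec (θ : ℝ) : Plane := !₂[Real.cos θ, Real.sin θ]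

/-- The unit angular vector at the polar angle `θ`. -/
def angularVec (θ : ℝ) : Plane := !₂[-Real.sin θ, Real.cos θ]

theorem radialVec_eq (θ : ℝ) :
    radialVec θ = Real.cos θ • unitVec 0 + Real.sin θ • unitVec 1 := by
  ext i; fin_cases i <;> simp [radialVec, unitVec]

theorem angularVec_eq (θ : ℝ) :
    angularVec θ = -Real.sin θ • unitVec 0 + Real.cos θ • unitVec 1 := by
  ext i; fin_cases i <;> simp [angularVec, unitVec]

@[fun_prop]
theorem continuous_radialVec : Continuous radialVec := by
  simp_rw [funext radialVec_eq]; fun_prop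

@[fun_prop]
theorem continuous_angularVec : Continuous angularVec := by
  simp_rw [funext angularVec_eq]; fun_prop

theorem hasDerivAt_radialVec (θ : ℝ) : HasDerivAt radialVec (angularVec θ) θ := by
  rw [funext radialVec_eq, angularVec_eq]
  exact ((Real.hasDerivAt_cos θ).smul_const _).add ((Real.hasDerivAt_sin θ).smul_const _)

theorem hasDerivAt_angularVec (θ : ℝ) : HasDerivAt angularVec (-radialVec θ) θ := by
  rw [funext angularVec_eq, radialVec_eq]
  refine (((Real.hasDerivAt_sin θ).neg.smul_const _).add
    ((Real.hasDerivAt_cos θ).smul_const _)).congr_deriv ?_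
  module

theorem norm_radialVec (θ : ℝ) : ‖radialVec θ‖ = 1 := by
  have : ‖radialVec θ‖ ^ 2 = 1 := by rw [plane_norm_sq]; simp [radialVec]
  exact (pow_eq_one_iff_of_nonneg (norm_nonneg _) two_ne_zero).1 this

/-- The point with polar coordinates `(r, θ)` about `p`. -/
def polarPoint (p : Plane) (r θ : ℝ) : Plane := p + r • radialVec θ

theorem norm_polarPoint_sub (p : Plane) {r : ℝ} (hr : 0 < r) (θ : ℝ) :
    ‖polarPoint p r θ - p‖ = r := by
  simp [polarPoint, norm_smul, norm_radialVec, abs_of_pos hr]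

/-- After translating p to the origin, the polar coordinates of ℂ are carried over by the isometry
of the basis 1, i. -/
theorem integral_polarPoint (p : Plane) (H : Plane → ℂ) :
    ∫ x, H x = ∫ q in Ioi (0 : ℝ) ×ˢ Ioo (-Real.pi) Real.pi, q.1 • H (polarPoint p q.1 q.2) := by
  have h1 : ∫ x, H x = ∫ x, H (p + x) := (integral_add_left_eq_self H p).symm
  have h2 := (Complex.orthonormalBasisOneI.repr.measurePreserving).integral_comp
    Complex.orthonormalBasisOneI.repr.toHomeomorph.measurableEmbedding (fun x => H (p + x))
  rw [h1, ← h2, ← Complex.integral_comp_polarCoord_symm, polarCoord_target]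
  refine setIntegral_congr_fun (measurableSet_Ioi.prod measurableSet_Ioo) fun q _ => ?_
  have h3 : Complex.orthonormalBasisOneI.repr (Complex.polarCoord.symm q)
      = q.1 • radialVec q.2 := by
    ext i
    rw [Complex.polarCoord_symm_apply, Complex.orthonormalBasisOneI_repr_apply]
    fin_cases i <;> simp [radialVec, -Complex.ofReal_cos, -Complex.ofReal_sin]
  simp only [h3, polarPoint]

/-- The trace of a bilinear form is the same in every orthonormal frame; the mixed terms cancel
without symmetry of the second derivative. -/
theorem laplacian_eq_fderiv_fderiv (φ : Plane → ℂ) (x : Plane) (θ : ℝ) :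
    (Δ φ) x = fderiv ℝ (fderiv ℝ φ) x (radialVec θ) (radialVec θ)
      + fderiv ℝ (fderiv ℝ φ) x (angularVec θ) (angularVec θ) := by
  rw [InnerProductSpace.laplacian_eq_iteratedFDeriv_orthonormalBasis _
    (EuclideanSpace.basisFun (Fin 2) ℝ), radialVec_eq, angularVec_eq]
  simp only [Fin.sum_univ_two, EuclideanSpace.basisFun_apply, iteratedFDeriv_two_apply,
    Matrix.cons_val_zero, Matrix.cons_val_one, map_add, map_smul, add_apply,
    smul_apply, Complex.real_smul, unitVec, Complex.ofReal_neg]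
  have := Real.cos_sq_add_sin_sq θ
  have h : (Real.cos θ : ℂ) ^ 2 + (Real.sin θ : ℂ) ^ 2 = 1 := by exact_mod_cast this
  generalize fderiv ℝ (fderiv ℝ φ) x = B
  linear_combination (-(B (EuclideanSpace.single 0 1) (EuclideanSpace.single 0 1))
    - B (EuclideanSpace.single 1 1) (EuclideanSpace.single 1 1)) * h

/-- A compactly supported function vanishes with its derivatives outside a ball. -/
theorem exists_radius_of_hasCompactSupport {φ : Plane → ℂ} (hc : HasCompactSupport φ) (p : Plane) :
    ∃ R : ℝ, 0 ≤ R ∧ ∀ x, R < ‖x - p‖ →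
      φ x = 0 ∧ fderiv ℝ φ x = 0 ∧ fderiv ℝ (fderiv ℝ φ) x = 0 := by
  obtain ⟨R, hR⟩ := hc.isCompact.isBounded.subset_closedBall p
  refine ⟨max R 0, le_max_right _ _, fun x hx => ?_⟩
  have h0 : x ∉ tsupport φ := fun h => by
    have := hR h
    rw [Metric.mem_closedBall, dist_eq_norm] at this
    exact absurd (this.trans (le_max_left _ _)) (not_le.2 hx)
  have h1 : x ∉ tsupport (fderiv ℝ φ) := fun h => h0 (tsupport_fderiv_subset ℝ h)
  have h2 : x ∉ tsupport (fderiv ℝ (fderiv ℝ φ)) := fun h => h1 (tsupport_fderiv_subset ℝ h)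
  exact ⟨image_eq_zero_of_notMem_tsupport h0, image_eq_zero_of_notMem_tsupport h1,
    image_eq_zero_of_notMem_tsupport h2⟩

/-! ### Green's identity and the point mass. -/

section TestFunction

variable {φ : Plane → ℂ}

theorem hasDerivAt_polarPoint_radial (hφ : ContDiff ℝ 2 φ) (p : Plane) (r θ : ℝ) :
    HasDerivAt (fun r => φ (polarPoint p r θ))
      (fderiv ℝ φ (polarPoint p r θ) (radialVec θ)) r := by
  have h1 : HasDerivAt (fun r => polarPoint p r θ) (radialVec θ) r := by
    simpa [polarPoint] using ((hasDerivAt_id r).smul_const (radialVec θ)).const_add p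
  exact ((hφ.differentiable two_ne_zero).differentiableAt.hasFDerivAt).comp_hasDerivAt r h1

theorem hasDerivAt_fderiv_polarPoint_radial (hφ : ContDiff ℝ 2 φ) (p : Plane) (r θ : ℝ) :
    HasDerivAt (fun r => fderiv ℝ φ (polarPoint p r θ) (radialVec θ))
      (fderiv ℝ (fderiv ℝ φ) (polarPoint p r θ) (radialVec θ) (radialVec θ)) r := by
  have h1 : HasDerivAt (fun r => polarPoint p r θ) (radialVec θ) r := by
    simpa [polarPoint] using ((hasDerivAt_id r).smul_const (radialVec θ)).const_add p
  have hd : Differentiable ℝ (fderiv ℝ φ) :=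
    (hφ.fderiv_right (m := 1) (by norm_num)).differentiable one_ne_zero
  have h2 := (hd.differentiableAt.hasFDerivAt).comp_hasDerivAt r h1
  simpa using h2.clm_apply (hasDerivAt_const r (radialVec θ))

/-- Turning the frame produces the term -∂ᵣφ. It is this combination that is a θ-derivative, and
`integral_ray` carries the compensating +∂ᵣφ. -/
theorem hasDerivAt_fderiv_polarPoint_angular (hφ : ContDiff ℝ 2 φ) (p : Plane) (r θ : ℝ) :
    HasDerivAt (fun θ => fderiv ℝ φ (polarPoint p r θ) (angularVec θ))
      (r * fderiv ℝ (fderiv ℝ φ) (polarPoint p r θ) (angularVec θ) (angularVec θ)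
        - fderiv ℝ φ (polarPoint p r θ) (radialVec θ)) θ := by
  have h1 : HasDerivAt (fun θ => polarPoint p r θ) (r • angularVec θ) θ :=
    ((hasDerivAt_radialVec θ).const_smul r).const_add p
  have hd : Differentiable ℝ (fderiv ℝ φ) :=
    (hφ.fderiv_right (m := 1) (by norm_num)).differentiable one_ne_zero
  have h2 := (hd.differentiableAt.hasFDerivAt).comp_hasDerivAt θ h1
  refine (h2.clm_apply (hasDerivAt_angularVec θ)).congr_deriv ?_
  simp
  ring

theorem continuous_polarPoint (p : Plane) :
    Continuous (fun q : ℝ × ℝ => polarPoint p q.1 q.2) := by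
  unfold polarPoint; fun_prop

theorem continuous_fderiv_fderiv (hφ : ContDiff ℝ 2 φ) : Continuous (fderiv ℝ (fderiv ℝ φ)) :=
  (hφ.fderiv_right (m := 1) (by norm_num)).continuous_fderiv one_ne_zero

/-- For fixed radius the angular part of the Laplacian integrates to zero. -/
theorem integral_angular (hφ : ContDiff ℝ 2 φ) (p : Plane) (r : ℝ) :
    ∫ θ in Ioo (-Real.pi) Real.pi,
      (r * fderiv ℝ (fderiv ℝ φ) (polarPoint p r θ) (angularVec θ) (angularVec θ)
        - fderiv ℝ φ (polarPoint p r θ) (radialVec θ)) = 0 := by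
  have hpi : -Real.pi ≤ Real.pi := by linarith [Real.pi_pos]
  rw [← integral_Ioc_eq_integral_Ioo, ← intervalIntegral.integral_of_le hpi]
  have hT : Continuous (fun θ => polarPoint p r θ) :=
    (continuous_polarPoint p).comp (by fun_prop : Continuous fun θ : ℝ => (r, θ))
  have c1 : Continuous fun θ => fderiv ℝ φ (polarPoint p r θ) :=
    (hφ.continuous_fderiv two_ne_zero).comp hT
  have c2 : Continuous fun θ => fderiv ℝ (fderiv ℝ φ) (polarPoint p r θ) :=
    (continuous_fderiv_fderiv hφ).comp hT
  rw [intervalIntegral.integral_eq_sub_of_hasDerivAt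
    (fun θ _ => hasDerivAt_fderiv_polarPoint_angular hφ p r θ)]
  -- The angles -π and π give the same point and the same frame.
  · simp [polarPoint, radialVec, angularVec]
  · refine Continuous.intervalIntegrable ?_ _ _
    fun_prop

/-- The radial Green identity along a ray. -/
theorem integral_ray (hφ : ContDiff ℝ 2 φ) (hc : HasCompactSupport φ) {κ : ℝ} (hκ : 0 < κ)
    (p : Plane) (θ : ℝ) :
    ∫ r in Ioi (0 : ℝ), outgoingProfile (κ * r) *
      (r * fderiv ℝ (fderiv ℝ φ) (polarPoint p r θ) (radialVec θ) (radialVec θ)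
        + fderiv ℝ φ (polarPoint p r θ) (radialVec θ) + κ ^ 2 * r * φ (polarPoint p r θ))
      = -φ p := by
  obtain ⟨R, hR0, hR⟩ := exists_radius_of_hasCompactSupport hc p
  have hT : Continuous (fun r => polarPoint p r θ) :=
    (continuous_polarPoint p).comp (by fun_prop : Continuous fun r : ℝ => (r, θ))
  have c0 : Continuous fun r => φ (polarPoint p r θ) := hφ.continuous.comp hT
  have c1 : Continuous fun r => fderiv ℝ φ (polarPoint p r θ) :=
    (hφ.continuous_fderiv two_ne_zero).comp hT
  have c2 : Continuous fun r => fderiv ℝ (fderiv ℝ φ) (polarPoint p r θ) :=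
    (continuous_fderiv_fderiv hφ).comp hT
  have hfar : ∀ r, R < r → φ (polarPoint p r θ) = 0 ∧ fderiv ℝ φ (polarPoint p r θ) = 0 ∧
      fderiv ℝ (fderiv ℝ φ) (polarPoint p r θ) = 0 := fun r hr =>
    hR _ (by rwa [norm_polarPoint_sub p (hR0.trans_lt hr)])
  have hκ' : (κ : ℂ) ≠ 0 := by exact_mod_cast hκ.ne'
  -- With F(r) = K₀(-iκr), the integrand is the derivative of rFφᵣ - rF'φ by Bessel's equation. At
  -- 0, rF → 0 and rF' → -1, so the boundary value there is φ(p); at infinity φ vanishes.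
  have key := integral_Ioi_of_hasDerivAt_of_tendsto_of_tendsto (a := 0) (m := φ p) (n := 0)
    (f := fun r => (r * outgoingProfile (κ * r)) * fderiv ℝ φ (polarPoint p r θ) (radialVec θ)
      - (κ * r * outgoingProfileDeriv (κ * r)) * φ (polarPoint p r θ))
    (f' := fun r => outgoingProfile (κ * r) *
      (r * fderiv ℝ (fderiv ℝ φ) (polarPoint p r θ) (radialVec θ) (radialVec θ)
        + fderiv ℝ φ (polarPoint p r θ) (radialVec θ) + κ ^ 2 * r * φ (polarPoint p r θ)))
    ?_ ?_ ?_ ?_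
  · rw [key, zero_sub]
  · intro r hr
    have hr : 0 < r := hr
    have hr' : (r : ℂ) ≠ 0 := by exact_mod_cast hr.ne'
    have d0 : HasDerivAt (fun s : ℝ => (s : ℂ)) 1 r := by
      simpa using (hasDerivAt_id r).ofReal_comp
    have d1 := hasDerivAt_outgoingProfile_mul hκ hr
    have d2 := hasDerivAt_outgoingProfileDeriv_mul hκ hr
    refine (((d0.mul d1).mul (hasDerivAt_fderiv_polarPoint_radial hφ p r θ)).sub
      (((d0.const_mul (κ : ℂ)).mul d2).mul (hasDerivAt_polarPoint_radial hφ p r θ))).congr_deriv ?_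
    simp only [Pi.mul_apply]
    field_simp
    ring
  · refine integrableOn_outgoingProfile_mul_continuous hκ hR0 (by fun_prop) fun r hr => ?_
    obtain ⟨h0, h1, h2⟩ := hfar r hr
    simp [h0, h1, h2]
  · have hmul : Tendsto (fun r : ℝ => κ * r) (𝓝[>] 0) (𝓝[>] 0) := by
      refine tendsto_nhdsWithin_iff.2 ⟨?_, ?_⟩
      · have : Continuous (fun r : ℝ => κ * r) := by fun_prop
        simpa using (this.tendsto 0).mono_left nhdsWithin_le_nhds
      · filter_upwards [self_mem_nhdsWithin] with r hr using mul_pos hκ hr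
    have t1 := (tendsto_mul_outgoingProfile.comp hmul).const_mul (κ : ℂ)⁻¹
    have t2 := tendsto_mul_outgoingProfileDeriv.comp hmul
    have t3 : Tendsto (fun r => fderiv ℝ φ (polarPoint p r θ) (radialVec θ)) (𝓝[>] 0)
        (𝓝 (fderiv ℝ φ (polarPoint p 0 θ) (radialVec θ))) :=
      ((by fun_prop : Continuous _).tendsto 0).mono_left nhdsWithin_le_nhds
    have t4 : Tendsto (fun r => φ (polarPoint p r θ)) (𝓝[>] 0) (𝓝 (φ (polarPoint p 0 θ))) :=
      (c0.tendsto 0).mono_left nhdsWithin_le_nhds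
    have := (t1.mul t3).sub (t2.mul t4)
    simp only [mul_zero, zero_mul, zero_sub, neg_mul, one_mul, neg_neg] at this
    rw [show polarPoint p 0 θ = p by simp [polarPoint]] at this
    refine this.congr fun r => ?_
    simp only [Function.comp]
    push_cast
    field_simp
  · refine tendsto_const_nhds.congr' ?_
    filter_upwards [Ioi_mem_atTop R] with r hr
    obtain ⟨h0, h1, -⟩ := hfar r hr
    simp [h0, h1]

/-- `K₀(-iκ|x - p|) / 2π` is a fundamental solution of `-(Δ + κ²)`. -/
theorem integral_outgoingField_mul (hφ : ContDiff ℝ 2 φ) (hc : HasCompactSupport φ) {κ : ℝ}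
    (hκ : 0 < κ) (p : Plane) :
    ∫ x, outgoingField κ p x * ((Δ φ) x + κ ^ 2 * φ x) = -(2 * Real.pi) * φ p := by
  obtain ⟨R, hR0, hR⟩ := exists_radius_of_hasCompactSupport hc p
  have hfar : ∀ r θ, R < r → φ (polarPoint p r θ) = 0 ∧ fderiv ℝ φ (polarPoint p r θ) = 0 ∧
      fderiv ℝ (fderiv ℝ φ) (polarPoint p r θ) = 0 := fun r θ hr =>
    hR _ (by rwa [norm_polarPoint_sub p (hR0.trans_lt hr)])
  have hT := continuous_polarPoint p
  have c0 : Continuous fun q : ℝ × ℝ => φ (polarPoint p q.1 q.2) := hφ.continuous.comp hT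
  have c1 : Continuous fun q : ℝ × ℝ => fderiv ℝ φ (polarPoint p q.1 q.2) :=
    (hφ.continuous_fderiv two_ne_zero).comp hT
  have c2 : Continuous fun q : ℝ × ℝ => fderiv ℝ (fderiv ℝ φ) (polarPoint p q.1 q.2) :=
    (continuous_fderiv_fderiv hφ).comp hT
  -- r(Δφ + κ²φ) = a + b, with ∂ᵣφ added to the radial part a and subtracted from the angular part
  -- b. For fixed r, b integrates to 0 over the circle; for fixed θ, a integrates to -φ(p) over the
  -- ray, whence 2π.
  set a : ℝ × ℝ → ℂ := fun q =>
    q.1 * fderiv ℝ (fderiv ℝ φ) (polarPoint p q.1 q.2) (radialVec q.2) (radialVec q.2)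
      + fderiv ℝ φ (polarPoint p q.1 q.2) (radialVec q.2)
      + κ ^ 2 * q.1 * φ (polarPoint p q.1 q.2) with ha
  set b : ℝ × ℝ → ℂ := fun q =>
    q.1 * fderiv ℝ (fderiv ℝ φ) (polarPoint p q.1 q.2) (angularVec q.2) (angularVec q.2)
      - fderiv ℝ φ (polarPoint p q.1 q.2) (radialVec q.2) with hb
  have hai := integrableOn_outgoingProfile_mul_continuous_prod hκ hR0 (c := a)
    (by simp only [ha]; fun_prop) (fun r θ hr => by
      obtain ⟨h0, h1, h2⟩ := hfar r θ hr
      simp [ha, h0, h1, h2])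
  have hbi := integrableOn_outgoingProfile_mul_continuous_prod hκ hR0 (c := b)
    (by simp only [hb]; fun_prop) (fun r θ hr => by
      obtain ⟨h0, h1, h2⟩ := hfar r θ hr
      simp [hb, h1, h2])
  have hB : ∫ q in Ioi (0 : ℝ) ×ˢ Ioo (-Real.pi) Real.pi, outgoingProfile (κ * q.1) * b q = 0 := by
    rw [Measure.volume_eq_prod, setIntegral_prod _ hbi]
    refine (integral_congr_ae (Eventually.of_forall fun r => ?_)).trans (integral_zero ℝ ℂ)
    simp only [integral_const_mul]
    rw [integral_angular hφ p r, mul_zero]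
  have hA : ∫ q in Ioi (0 : ℝ) ×ˢ Ioo (-Real.pi) Real.pi, outgoingProfile (κ * q.1) * a q
      = -(2 * Real.pi) * φ p := by
    rw [Measure.volume_eq_prod, setIntegral_prod _ hai, integral_integral_swap]
    · simp only [ha, integral_ray hφ hc hκ p]
      rw [setIntegral_const, Measure.real, Real.volume_Ioo, ENNReal.toReal_ofReal]
      · rw [Complex.real_smul]; push_cast; ring
      · linarith [Real.pi_pos]
    · rw [Measure.prod_restrict]
      exact hai
  rw [integral_polarPoint p, ← hA, ← add_zero (∫ q in _, outgoingProfile (κ * q.1) * a q), ← hB,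
    ← integral_add hai hbi]
  refine setIntegral_congr_fun (measurableSet_Ioi.prod measurableSet_Ioo) fun q hq => ?_
  simp only [outgoingField, norm_polarPoint_sub p hq.1, laplacian_eq_fderiv_fderiv φ _ q.2, ha, hb,
    Complex.real_smul]
  ring

end TestFunction

/-! ### The radiation condition. -/

theorem norm_outgoingProfileDeriv_le {x : ℝ} (hx : 0 < x) :
    ‖outgoingProfileDeriv x‖ ≤ x⁻¹ + Real.Gamma (1 / 2) * x ^ (-(1 / 2) : ℝ) := by
  have h : outgoingProfileDeriv x = (outgoingProfileDeriv x - Complex.I * outgoingProfile x)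
      + Complex.I * outgoingProfile x := by ring
  rw [h]
  refine (norm_add_le _ _).trans (add_le_add (norm_outgoingProfileDeriv_sub_le hx) ?_)
  simpa using norm_outgoingProfile_le hx

/-- The Sommerfeld condition differentiates along x/|x|, the wave along x - p. The discrepancy is
bounded: one ‖p‖ comes from Cauchy-Schwarz, one from the triangle inequality. -/
theorem abs_inner_direction_sub_norm_le {x : Plane} (hx : x ≠ 0) (p : Plane) :
    |inner ℝ (x - p) (‖x‖⁻¹ • x) - ‖x - p‖| ≤ 2 * ‖p‖ := by
  have hN : 0 < ‖x‖ := norm_pos_iff.2 hx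
  have h1 : inner ℝ (x - p) (‖x‖⁻¹ • x) = ‖x‖ - inner ℝ p (‖x‖⁻¹ • x) := by
    rw [inner_sub_left, real_inner_smul_right, real_inner_self_eq_norm_sq]
    field_simp
  have h2 : |inner ℝ p (‖x‖⁻¹ • x)| ≤ ‖p‖ := by
    refine (abs_real_inner_le_norm _ _).trans (le_of_eq ?_)
    rw [norm_smul, norm_inv, norm_norm, inv_mul_cancel₀ hN.ne', mul_one]
  have h3 : |‖x‖ - ‖x - p‖| ≤ ‖p‖ := by simpa using abs_norm_sub_norm_le x (x - p)
  rw [h1]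
  calc |‖x‖ - inner ℝ p (‖x‖⁻¹ • x) - ‖x - p‖|
      = |(‖x‖ - ‖x - p‖) - inner ℝ p (‖x‖⁻¹ • x)| := by ring_nf
    _ ≤ |‖x‖ - ‖x - p‖| + |inner ℝ p (‖x‖⁻¹ • x)| := abs_sub _ _
    _ ≤ 2 * ‖p‖ := by linarith

theorem sommerfeld_outgoingField {κ : ℝ} (hκ : 0 < κ) (Ω : Set Plane) (p : Plane) :
    Sommerfeld κ Ω (outgoingField κ p) := by
  -- A bounds K' on [κ/2, ∞), where the argument κ|x - p| lies once |x - p| ≥ 1/2.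
  set A : ℝ := (κ / 2)⁻¹ + Real.Gamma (1 / 2) * (κ / 2) ^ (-(1 / 2) : ℝ) with hA
  have hΓ : 0 < Real.Gamma (1 / 2) := Real.Gamma_pos_of_pos (by norm_num)
  have hA0 : 0 < A := by positivity
  have hlim : Tendsto (fun x : Plane => (2 + 4 * κ * A * ‖p‖) * (√‖x‖)⁻¹)
      (Bornology.cobounded Plane ⊓ 𝓟 Ω) (𝓝 0) := by
    have := (tendsto_inv_atTop_zero.comp (Real.tendsto_sqrt_atTop.comp
      (tendsto_norm_cobounded_atTop (E := Plane)))).const_mul (2 + 4 * κ * A * ‖p‖)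
    rw [mul_zero] at this
    exact this.mono_left inf_le_left
  refine squeeze_zero_norm' ?_ hlim
  refine Filter.Eventually.filter_mono inf_le_left ?_
  -- This threshold gives |x - p| ≥ |x|/2 ≥ 1/2.
  filter_upwards [tendsto_norm_cobounded_atTop.eventually_ge_atTop (2 * ‖p‖ + 1)] with x hx
  have hp := norm_nonneg p
  have hN : 1 ≤ ‖x‖ := by linarith
  have hx0 : x ≠ 0 := norm_pos_iff.1 (by linarith)
  have hr : ‖x‖ / 2 ≤ ‖x - p‖ := by linarith [norm_sub_norm_le x p]
  have hr0 : 0 < ‖x - p‖ := by linarith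
  have hxp : x ≠ p := sub_ne_zero.1 (norm_pos_iff.1 hr0)
  have hdir := abs_inner_direction_sub_norm_le hx0 p
  rw [(hasFDerivAt_outgoingField hκ hxp).fderiv]
  simp only [ContinuousLinearMap.smulRight_apply, innerSL_apply_apply, Complex.real_smul,
    outgoingField]
  set r := ‖x - p‖ with hrdef
  set d : ℝ := inner ℝ (x - p) (‖x‖⁻¹ • x) with hd
  have hr' : (r : ℂ) ≠ 0 := by exact_mod_cast hr0.ne'
  -- The defect K' - iK plus the mismatch of directions. Each is O(1/|x|), which beats the factor
  -- √|x|.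
  have hsplit : (d : ℂ) * (κ * outgoingProfileDeriv (κ * r) / r)
      - Complex.I * κ * outgoingProfile (κ * r)
      = κ * (outgoingProfileDeriv (κ * r) - Complex.I * outgoingProfile (κ * r))
        + κ * outgoingProfileDeriv (κ * r) * (((d - r) / r : ℝ) : ℂ) := by
    push_cast
    field_simp
    ring
  have hκr : 0 < κ * r := by positivity
  have hκr2 : κ / 2 ≤ κ * r := by nlinarith
  have b1 : ‖κ * (outgoingProfileDeriv (κ * r) - Complex.I * outgoingProfile (κ * r))‖
      ≤ 2 / ‖x‖ := by
    rw [norm_mul, Complex.norm_real, Real.norm_eq_abs, abs_of_pos hκ]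
    calc κ * ‖_‖ ≤ κ * (κ * r)⁻¹ := by gcongr; exact norm_outgoingProfileDeriv_sub_le hκr
      _ = r⁻¹ := by field_simp
      _ ≤ (‖x‖ / 2)⁻¹ := by gcongr
      _ = 2 / ‖x‖ := by rw [inv_div]
  have b2 : ‖outgoingProfileDeriv (κ * r)‖ ≤ A := by
    refine (norm_outgoingProfileDeriv_le hκr).trans ?_
    rw [hA]
    have := Real.rpow_le_rpow_of_nonpos (by positivity) hκr2 (by norm_num : (-(1 / 2) : ℝ) ≤ 0)
    gcongr
  have b3 : |(d - r) / r| ≤ 4 * ‖p‖ / ‖x‖ := by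
    rw [abs_div, abs_of_pos hr0, div_le_div_iff₀ hr0 (by linarith)]
    nlinarith
  have b4 : ‖κ * outgoingProfileDeriv (κ * r) * (((d - r) / r : ℝ) : ℂ)‖
      ≤ κ * A * (4 * ‖p‖ / ‖x‖) := by
    rw [norm_mul, norm_mul, Complex.norm_real, Complex.norm_real, Real.norm_eq_abs,
      Real.norm_eq_abs, abs_of_pos hκ]
    gcongr
  rw [hsplit, norm_mul, Complex.norm_real, Real.norm_eq_abs, abs_of_nonneg (Real.sqrt_nonneg _)]
  calc √‖x‖ * ‖_‖ ≤ √‖x‖ * (2 / ‖x‖ + κ * A * (4 * ‖p‖ / ‖x‖)) := by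
        gcongr; exact (norm_add_le _ _).trans (add_le_add b1 b4)
    _ = (2 + 4 * κ * A * ‖p‖) * (√‖x‖)⁻¹ := by
        rw [← Real.sqrt_div_self]; ring

/-- Differentiability is asked for only near infinity, so the singular points do not interfere. -/
theorem Sommerfeld.const_mul {k : ℝ} {Ω : Set Plane} {f : Plane → ℂ} (hf : Sommerfeld k Ω f)
    (c : ℂ) (df : ∀ᶠ x in Bornology.cobounded Plane, DifferentiableAt ℝ f x) :
    Sommerfeld k Ω (fun x => c * f x) := by
  have := Tendsto.const_mul c hf
  rw [mul_zero] at this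
  refine this.congr' ?_
  filter_upwards [df.filter_mono inf_le_left] with x hx
  rw [fderiv_const_mul hx]
  simp
  ring

theorem Sommerfeld.add {k : ℝ} {Ω : Set Plane} {f g : Plane → ℂ} (hf : Sommerfeld k Ω f)
    (hg : Sommerfeld k Ω g) (df : ∀ᶠ x in Bornology.cobounded Plane, DifferentiableAt ℝ f x)
    (dg : ∀ᶠ x in Bornology.cobounded Plane, DifferentiableAt ℝ g x) :
    Sommerfeld k Ω (fun x => f x + g x) := by
  have := Tendsto.add hf hg
  rw [add_zero] at this
  refine this.congr' ?_
  filter_upwards [df.filter_mono inf_le_left, dg.filter_mono inf_le_left] with x hx hx'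
  rw [fderiv_fun_add hx hx']
  simp
  ring

theorem eventually_cobounded_ne (p : Plane) : ∀ᶠ x in Bornology.cobounded Plane, x ≠ p := by
  filter_upwards [tendsto_norm_cobounded_atTop.eventually_gt_atTop ‖p‖] with x hx h
  rw [h] at hx
  exact lt_irrefl _ hx

theorem differentiableAt_outgoingField {κ : ℝ} (hκ : 0 < κ) {p x : Plane} (hx : x ≠ p) :
    DifferentiableAt ℝ (outgoingField κ p) x :=
  (hasFDerivAt_outgoingField hκ hx).differentiableAt

/-! ### The image point and the scalar half-plane Green's function. -/

/-- The mirror image of a point in the boundary `x₂ = 0`. -/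
def imagePoint (ξ : Plane) : Plane := !₂[ξ 0, -ξ 1]

theorem dist1_eq (x ξ : Plane) : dist1 x ξ = ‖x - ξ‖ := by
  rw [dist1, ← Real.sqrt_sq (norm_nonneg (x - ξ)), plane_norm_sq]
  simp

theorem distImage_eq (x ξ : Plane) : distImage x ξ = ‖x - imagePoint ξ‖ := by
  rw [distImage, ← Real.sqrt_sq (norm_nonneg (x - imagePoint ξ)), plane_norm_sq]
  simp [imagePoint]

theorem ne_imagePoint {ξ x : Plane} (hξ : ξ ∈ lowerHalfPlane) (hx : x 1 ≤ 0) :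
    x ≠ imagePoint ξ := by
  rintro rfl
  have h : ξ 1 < 0 := hξ
  simp [imagePoint] at hx
  linarith

theorem ne_of_boundary {ξ x : Plane} (hξ : ξ ∈ lowerHalfPlane) (hx : x 1 = 0) : x ≠ ξ := by
  rintro rfl
  have h : x 1 < 0 := hξ
  linarith

theorem waveNumber_pos {μ ρ ω : ℝ} (hμ : 0 < μ) (hρ : 0 < ρ) (hω : 0 < ω) :
    0 < waveNumber μ ρ ω := mul_pos (Real.sqrt_pos.2 (div_pos hρ hμ)) hω

theorem mul_waveNumber_sq {μ ρ : ℝ} (ω : ℝ) (hμ : 0 < μ) (hρ : 0 < ρ) :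
    μ * waveNumber μ ρ ω ^ 2 = ρ * ω ^ 2 := by
  rw [waveNumber, mul_pow, Real.sq_sqrt (div_pos hρ hμ).le]
  field_simp

theorem isoFundamental_eq (μ ρ ω r : ℝ) :
    isoFundamental μ ρ ω r = 1 / (2 * Real.pi * μ) * outgoingProfile (waveNumber μ ρ ω * r) := by
  rw [isoFundamental, outgoingProfile]
  push_cast
  rw [mul_assoc (-Complex.I)]

theorem isoFundamental_dist1 (μ ρ ω : ℝ) (ξ x : Plane) : isoFundamental μ ρ ω (dist1 x ξ)
    = 1 / (2 * Real.pi * μ) * outgoingField (waveNumber μ ρ ω) ξ x := by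
  rw [isoFundamental_eq, dist1_eq, outgoingField]

theorem isoFundamental_distImage (μ ρ ω : ℝ) (ξ x : Plane) : isoFundamental μ ρ ω (distImage x ξ)
    = 1 / (2 * Real.pi * μ) * outgoingField (waveNumber μ ρ ω) (imagePoint ξ) x := by
  rw [isoFundamental_eq, distImage_eq, outgoingField]

theorem isoGreen_eq_add (μ ρ ω : ℝ) (ξ x : Plane) : isoGreen μ ρ ω ξ x
    = isoFundamental μ ρ ω (dist1 x ξ) + isoFundamental μ ρ ω (distImage x ξ) := by
  rw [isoGreen, isoFundamental, isoFundamental, mul_add]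

theorem isoGreen_eq (μ ρ ω : ℝ) (ξ : Plane) : isoGreen μ ρ ω ξ = fun x =>
    1 / (2 * Real.pi * μ) * (outgoingField (waveNumber μ ρ ω) ξ x
      + outgoingField (waveNumber μ ρ ω) (imagePoint ξ) x) := by
  ext x
  rw [isoGreen_eq_add, isoFundamental_dist1, isoFundamental_distImage, mul_add]

section IsotropicGreen

variable {μ ρ ω : ℝ} {ξ : Plane}

theorem locallyIntegrable_isoGreen (hμ : 0 < μ) (hρ : 0 < ρ) (hω : 0 < ω) (ξ : Plane) :
    LocallyIntegrable (isoGreen μ ρ ω ξ) := by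
  have hκ := waveNumber_pos hμ hρ hω
  rw [isoGreen_eq]
  exact ((locallyIntegrable_outgoingField hκ ξ).add
    (locallyIntegrable_outgoingField hκ (imagePoint ξ))).smul (1 / (2 * Real.pi * μ) : ℂ)

theorem contDiff_two_of_contDiff_top {φ : Plane → ℂ} (hφ : ContDiff ℝ (⊤ : ℕ∞) φ) :
    ContDiff ℝ 2 φ := contDiff_infty.1 hφ 2

theorem continuous_laplacian {φ : Plane → ℂ} (hφ : ContDiff ℝ 2 φ) : Continuous (Δ φ) := by
  have h := continuous_fderiv_fderiv hφ
  rw [funext fun x => laplacian_eq_fderiv_fderiv φ x 0]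
  fun_prop

theorem tsupport_laplacian_subset (φ : Plane → ℂ) : tsupport (Δ φ) ⊆ tsupport φ := by
  refine closure_minimal (fun x hx => ?_) (isClosed_tsupport φ)
  by_contra h
  refine hx ?_
  have h2 : x ∉ tsupport (fderiv ℝ (fderiv ℝ φ)) := fun h' =>
    h (tsupport_fderiv_subset ℝ (tsupport_fderiv_subset ℝ h'))
  rw [laplacian_eq_fderiv_fderiv φ x 0, image_eq_zero_of_notMem_tsupport h2]
  simp

theorem hasCompactSupport_laplacian {φ : Plane → ℂ} (hc : HasCompactSupport φ) :
    HasCompactSupport (Δ φ) :=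
  IsCompact.of_isClosed_subset hc (isClosed_tsupport _) (tsupport_laplacian_subset φ)

theorem integrable_isoGreen_pairing (hμ : 0 < μ) (hρ : 0 < ρ) (hω : 0 < ω) (ξ : Plane)
    {φ : Plane → ℂ} (hφ : ContDiff ℝ 2 φ) (hc : HasCompactSupport φ) :
    Integrable (fun x => (μ : ℂ) * isoGreen μ ρ ω ξ x * (Δ φ) x
      + ρ * ω ^ 2 * isoGreen μ ρ ω ξ x * φ x) := by
  have hl := locallyIntegrable_isoGreen hμ hρ hω ξ
  have h1 := (hl.integrable_smul_right_of_hasCompactSupport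
    (continuous_laplacian hφ) (hasCompactSupport_laplacian hc)).const_mul (μ : ℂ)
  have h2 := (hl.integrable_smul_right_of_hasCompactSupport hφ.continuous hc).const_mul (ρ * ω ^ 2 : ℂ)
  refine (h1.add h2).congr (Eventually.of_forall fun x => ?_)
  simp only [Pi.add_apply, smul_eq_mul]
  ring

/-- The point-source equation of the isotropic half-plane Green's function. -/
theorem integral_isoGreen_pairing (hμ : 0 < μ) (hρ : 0 < ρ) (hω : 0 < ω)
    (hξ : ξ ∈ lowerHalfPlane) {φ : Plane → ℂ} (hφ : ContDiff ℝ 2 φ) (hc : HasCompactSupport φ)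
    (hs : tsupport φ ⊆ lowerHalfPlane) :
    ∫ x in lowerHalfPlane, ((μ : ℂ) * isoGreen μ ρ ω ξ x * (Δ φ) x
      + ρ * ω ^ 2 * isoGreen μ ρ ω ξ x * φ x) = -φ ξ := by
  have hκ := waveNumber_pos hμ hρ hω
  have hzero : ∀ x, x ∉ lowerHalfPlane → φ x = 0 ∧ (Δ φ) x = 0 := fun x hx =>
    ⟨image_eq_zero_of_notMem_tsupport fun h => hx (hs h),
      image_eq_zero_of_notMem_tsupport fun h => hx (hs (tsupport_laplacian_subset φ h))⟩
  -- The support of φ lies in the half-plane, so the whole-plane identity applies.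
  rw [setIntegral_eq_integral_of_forall_compl_eq_zero fun x hx => by
    rw [(hzero x hx).1, (hzero x hx).2]; ring]
  set κ := waveNumber μ ρ ω with hκdef
  have hg : Continuous fun x => (Δ φ) x + (κ : ℂ) ^ 2 * φ x :=
    (continuous_laplacian hφ).add (continuous_const.mul hφ.continuous)
  have hgc : HasCompactSupport fun x => (Δ φ) x + (κ : ℂ) ^ 2 * φ x :=
    (hasCompactSupport_laplacian hc).add (hc.mul_left (f := fun _ => (κ : ℂ) ^ 2))
  have i1 := (locallyIntegrable_outgoingField hκ ξ).integrable_smul_right_of_hasCompactSupport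
    hg hgc
  have i2 := (locallyIntegrable_outgoingField hκ
    (imagePoint ξ)).integrable_smul_right_of_hasCompactSupport hg hgc
  simp only [smul_eq_mul] at i1 i2
  -- The image source sits outside the support and its point mass contributes nothing.
  have himage : φ (imagePoint ξ) = 0 := by
    refine (hzero _ fun h => ?_).1
    exact ne_imagePoint hξ (le_of_lt h) rfl
  have hμ' : (μ : ℂ) ≠ 0 := by exact_mod_cast hμ.ne'
  have hpi : (Real.pi : ℂ) ≠ 0 := by exact_mod_cast Real.pi_ne_zero
  have hk : (μ : ℂ) * κ ^ 2 = ρ * ω ^ 2 := by exact_mod_cast mul_waveNumber_sq ω hμ hρ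
  have hcongr : ∀ x, (μ : ℂ) * isoGreen μ ρ ω ξ x * (Δ φ) x + ρ * ω ^ 2 * isoGreen μ ρ ω ξ x * φ x
      = 1 / (2 * Real.pi) * (outgoingField κ ξ x * ((Δ φ) x + κ ^ 2 * φ x)
        + outgoingField κ (imagePoint ξ) x * ((Δ φ) x + κ ^ 2 * φ x)) := by
    intro x
    rw [isoGreen_eq, ← hk]
    field_simp
    ring
  simp_rw [hcongr]
  rw [integral_const_mul, integral_add i1 i2, integral_outgoingField_mul hφ hc hκ,
    integral_outgoingField_mul hφ hc hκ, himage]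
  field_simp
  ring

theorem partialD_outgoingField {κ : ℝ} (hκ : 0 < κ) {p x : Plane} (hx : x ≠ p) (i : Fin 2) :
    partialD i (outgoingField κ p) x
      = (x - p) i * (κ * outgoingProfileDeriv (κ * ‖x - p‖) / ‖x - p‖) := by
  rw [partialD, (hasFDerivAt_outgoingField hκ hx).fderiv]
  simp [unitVec, EuclideanSpace.inner_single_right]

/-- On the boundary the normal derivatives of a source and its image are opposite. -/
theorem partialD_outgoingField_boundary {κ : ℝ} (hκ : 0 < κ) (hξ : ξ ∈ lowerHalfPlane) {x : Plane}
    (hx : x 1 = 0) :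
    partialD 1 (outgoingField κ ξ) x = -partialD 1 (outgoingField κ (imagePoint ξ)) x := by
  -- On the boundary the distances agree while the vertical offsets are -ξ₂ and ξ₂.
  have hd : ‖x - imagePoint ξ‖ = ‖x - ξ‖ := by
    rw [← distImage_eq, ← dist1_eq, dist1, distImage, hx]
    ring_nf
  rw [partialD_outgoingField hκ (ne_of_boundary hξ hx),
    partialD_outgoingField hκ (ne_imagePoint hξ hx.le), hd]
  simp [imagePoint, hx]

theorem contDiffAt_isoGreen (hμ : 0 < μ) (hρ : 0 < ρ) (hω : 0 < ω) (hξ : ξ ∈ lowerHalfPlane)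
    {x : Plane} (hx : x 1 ≤ 0) (hne : x ≠ ξ) : ContDiffAt ℝ 2 (isoGreen μ ρ ω ξ) x := by
  have hκ := waveNumber_pos hμ hρ hω
  rw [isoGreen_eq]
  exact contDiffAt_const.mul ((contDiffAt_outgoingField hκ hne).add
    (contDiffAt_outgoingField hκ (ne_imagePoint hξ hx)))

theorem partialD_isoGreen_boundary (hμ : 0 < μ) (hρ : 0 < ρ) (hω : 0 < ω)
    (hξ : ξ ∈ lowerHalfPlane) {x : Plane} (hx : x 1 = 0) :
    partialD 1 (isoGreen μ ρ ω ξ) x = 0 := by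
  have hκ := waveNumber_pos hμ hρ hω
  have d1 := differentiableAt_outgoingField hκ (ne_of_boundary hξ hx)
  have d2 := differentiableAt_outgoingField hκ (ne_imagePoint hξ hx.le)
  have h := partialD_outgoingField_boundary hκ hξ hx
  simp only [partialD] at h ⊢
  rw [isoGreen_eq, fderiv_const_mul (d1.fun_add d2), fderiv_fun_add d1 d2]
  simp [h]

theorem eventually_differentiableAt_isoGreen (hμ : 0 < μ) (hρ : 0 < ρ) (hω : 0 < ω) (ξ : Plane) :
    ∀ᶠ x in Bornology.cobounded Plane, DifferentiableAt ℝ (isoGreen μ ρ ω ξ) x := by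
  have hκ := waveNumber_pos hμ hρ hω
  filter_upwards [eventually_cobounded_ne ξ, eventually_cobounded_ne (imagePoint ξ)] with x h1 h2
  rw [isoGreen_eq]
  exact ((differentiableAt_outgoingField hκ h1).fun_add
    (differentiableAt_outgoingField hκ h2)).const_mul _

theorem sommerfeld_isoGreen (hμ : 0 < μ) (hρ : 0 < ρ) (hω : 0 < ω) (ξ : Plane) (Ω : Set Plane) :
    Sommerfeld (waveNumber μ ρ ω) Ω (isoGreen μ ρ ω ξ) := by
  have hκ := waveNumber_pos hμ hρ hω
  have hd : ∀ p, ∀ᶠ x in Bornology.cobounded Plane,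
      DifferentiableAt ℝ (outgoingField (waveNumber μ ρ ω) p) x := fun p =>
    (eventually_cobounded_ne p).mono fun x hx => differentiableAt_outgoingField hκ hx
  rw [isoGreen_eq]
  refine ((sommerfeld_outgoingField hκ Ω ξ).add (sommerfeld_outgoingField hκ Ω (imagePoint ξ))
    (hd _) (hd _)).const_mul _ ?_
  filter_upwards [hd ξ, hd (imagePoint ξ)] with x h1 h2 using h1.fun_add h2

theorem isIsotropicGreen_isoGreen (hμ : 0 < μ) (hρ : 0 < ρ) (hω : 0 < ω)
    (hξ : ξ ∈ lowerHalfPlane) : IsIsotropicGreen μ ρ ω ξ (isoGreen μ ρ ω ξ) := by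
  refine ⟨⟨(locallyIntegrable_isoGreen hμ hρ hω ξ).locallyIntegrableOn _, fun φ hφ hc hs =>
    integral_isoGreen_pairing hμ hρ hω hξ (contDiff_two_of_contDiff_top hφ) hc hs⟩,
    fun x hx => ⟨?_, ?_⟩, sommerfeld_isoGreen hμ hρ hω ξ _⟩
  · exact (contDiffAt_isoGreen hμ hρ hω hξ hx.le (ne_of_boundary hξ hx)).differentiableAt
      two_ne_zero
  · rw [partialD_isoGreen_boundary hμ hρ hω hξ hx, mul_zero]

end IsotropicGreen

/-! ### Diagonalization of the matrix of elastic constants. -/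

namespace Material

variable {M : Material}

/-- The eigenvalues of the matrix of elastic constants, indexed by the mode. -/
def modulus (M : Material) : Fin 2 → ℝ := ![M.a1, M.a2]

theorem discriminant_eq (M : Material) :
    M.C.trace ^ 2 - 4 * M.C.det = (M.c44 - M.K2) ^ 2 + 4 * M.R3 ^ 2 := by
  simp [C, Matrix.trace_fin_two, Matrix.det_fin_two]
  ring

theorem discriminant_nonneg (M : Material) : 0 ≤ M.C.trace ^ 2 - 4 * M.C.det := by
  rw [discriminant_eq]; positivity

theorem a1_add_a2 (M : Material) : M.a1 + M.a2 = M.c44 + M.K2 := by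
  simp only [a1, a2, C, Matrix.trace_fin_two]
  simp
  ring

theorem a1_mul_a2 (M : Material) : M.a1 * M.a2 = M.c44 * M.K2 - M.R3 ^ 2 := by
  have h := Real.sq_sqrt M.discriminant_nonneg
  have h2 : M.a1 * M.a2 = (M.C.trace ^ 2 - √(M.C.trace ^ 2 - 4 * M.C.det) ^ 2) / 4 := by
    simp only [a1, a2]; ring
  rw [h2, h]
  simp [C, Matrix.det_fin_two]
  ring

/-- The discriminant dominates (c₄₄ - K₂)². Besides a₁ > 0, this fixes the sign of sin ψ in
`eigenvector_psi`. -/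
theorem c44_le_a1 (M : Material) : M.c44 ≤ M.a1 := by
  have h : |M.c44 - M.K2| ≤ √(M.C.trace ^ 2 - 4 * M.C.det) := by
    refine Real.abs_le_sqrt ?_
    rw [discriminant_eq]
    nlinarith [sq_nonneg M.R3]
  have h2 := le_abs_self (M.c44 - M.K2)
  have h3 : M.C.trace = M.c44 + M.K2 := by simp [C, Matrix.trace_fin_two]
  rw [a1]
  linarith

theorem a1_pos (hc : 0 < M.c44) : 0 < M.a1 := hc.trans_le M.c44_le_a1

theorem a2_pos (hc : 0 < M.c44) (hdet : 0 < M.c44 * M.K2 - M.R3 ^ 2) : 0 < M.a2 := by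
  have h := M.a1_mul_a2
  exact pos_of_mul_pos_right (by rw [h]; exact hdet) (a1_pos hc).le

theorem modulus_pos (hc : 0 < M.c44) (hdet : 0 < M.c44 * M.K2 - M.R3 ^ 2) (l : Fin 2) :
    0 < M.modulus l := by
  fin_cases l
  · exact a1_pos hc
  · exact a2_pos hc hdet

/-- `(cos ψ, sin ψ)` is an eigenvector of the matrix of elastic constants for `a₁`. -/
theorem eigenvector_psi (M : Material) :
    M.c44 * Real.cos M.psi + M.R3 * Real.sin M.psi = M.a1 * Real.cos M.psi ∧
    M.R3 * Real.cos M.psi + M.K2 * Real.sin M.psi = M.a1 * Real.sin M.psi := by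
  by_cases h : M.R3 = 0 ∧ M.c44 = M.a1
  · rw [psi, if_pos h, ← h.2, h.1]
    simp
  · rw [psi, if_neg h]
    set d := √((M.c44 - M.a1) ^ 2 + M.R3 ^ 2) with hd
    have hpos : 0 < (M.c44 - M.a1) ^ 2 + M.R3 ^ 2 := by
      by_cases h0 : M.R3 = 0
      · have : M.c44 - M.a1 ≠ 0 := fun h' => h ⟨h0, sub_eq_zero.1 h'⟩
        positivity
      · positivity
    have hd0 : 0 < d := Real.sqrt_pos.2 hpos
    have hdsq : d ^ 2 = (M.c44 - M.a1) ^ 2 + M.R3 ^ 2 := Real.sq_sqrt hpos.le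
    have hle : |M.R3 / d| ≤ 1 := by
      rw [abs_div, abs_of_pos hd0, div_le_one hd0]
      exact Real.abs_le_sqrt (by nlinarith [sq_nonneg (M.c44 - M.a1)])
    have hcos : Real.cos (Real.arccos (M.R3 / d)) = M.R3 / d :=
      Real.cos_arccos (abs_le.1 hle).1 (abs_le.1 hle).2
    -- The arccosine has nonnegative sine, so a₁ ≥ c₄₄ selects the root.
    have hsin : Real.sin (Real.arccos (M.R3 / d)) = (M.a1 - M.c44) / d := by
      rw [Real.sin_arccos]
      have : 1 - (M.R3 / d) ^ 2 = ((M.a1 - M.c44) / d) ^ 2 := by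
        field_simp
        linarith
      rw [this, Real.sqrt_sq (div_nonneg (sub_nonneg.2 M.c44_le_a1) hd0.le)]
    -- The characteristic equation of C at a₁.
    have hq : M.R3 ^ 2 = (M.a1 - M.c44) * (M.a1 - M.K2) := by
      linear_combination M.a1_mul_a2 - M.a1 * M.a1_add_a2
    rw [hcos, hsin]
    constructor
    · field_simp; ring
    · field_simp; linear_combination hq

/-- With `elastic_phason`, the two rows of C q_l = a_l q_l. The second mode follows from the first:
(-sin ψ, cos ψ) has eigenvalue tr C - a₁ = a₂. -/
theorem elastic_phonon (M : Material) (l : Fin 2) :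
    (M.c44 : ℂ) * M.Q 0 l + M.R3 * M.Q 1 l = M.modulus l * M.Q 0 l := by
  have h1 : (M.c44 : ℂ) * Real.cos M.psi + M.R3 * Real.sin M.psi = M.a1 * Real.cos M.psi := by
    exact_mod_cast M.eigenvector_psi.1
  have h2 : (M.R3 : ℂ) * Real.cos M.psi + M.K2 * Real.sin M.psi = M.a1 * Real.sin M.psi := by
    exact_mod_cast M.eigenvector_psi.2
  have h3 : (M.a1 : ℂ) + M.a2 = M.c44 + M.K2 := by exact_mod_cast M.a1_add_a2
  fin_cases l <;> simp [Q, modulus, -Complex.ofReal_cos, -Complex.ofReal_sin]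
  · exact h1
  · linear_combination h2 + (Real.sin M.psi : ℂ) * h3

theorem elastic_phason (M : Material) (l : Fin 2) :
    (M.R3 : ℂ) * M.Q 0 l + M.K2 * M.Q 1 l = M.modulus l * M.Q 1 l := by
  have h1 : (M.c44 : ℂ) * Real.cos M.psi + M.R3 * Real.sin M.psi = M.a1 * Real.cos M.psi := by
    exact_mod_cast M.eigenvector_psi.1
  have h2 : (M.R3 : ℂ) * Real.cos M.psi + M.K2 * Real.sin M.psi = M.a1 * Real.sin M.psi := by
    exact_mod_cast M.eigenvector_psi.2
  have h3 : (M.a1 : ℂ) + M.a2 = M.c44 + M.K2 := by exact_mod_cast M.a1_add_a2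
  fin_cases l <;> simp [Q, modulus, -Complex.ofReal_cos, -Complex.ofReal_sin]
  · exact h2
  · linear_combination -h1 + (-(Real.cos M.psi : ℂ)) * h3

theorem Q_mul_transpose (M : Material) : M.Q * M.Q.transpose = 1 := by
  have h : (Real.cos M.psi : ℂ) ^ 2 + (Real.sin M.psi : ℂ) ^ 2 = 1 := by
    exact_mod_cast Real.cos_sq_add_sin_sq M.psi
  ext i j
  fin_cases i <;> fin_cases j <;>
    simp [Q, Matrix.mul_apply, Fin.sum_univ_two, -Complex.ofReal_cos, -Complex.ofReal_sin] <;>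
    first | linear_combination h | ring

/-- The spectral form v* = ∑ Φ_l q_l q_lᵀ, through which all matrix statements reduce to scalar
ones. -/
theorem vstar_apply (M : Material) (r ω : ℝ) (i j : Fin 2) :
    M.vstar r ω i j = M.Q i 0 * M.Q j 0 * isoFundamental M.a1 M.rho ω r
      + M.Q i 1 * M.Q j 1 * isoFundamental M.a2 M.rho ω r := by
  simp only [vstar, h, Matrix.mul_apply, Fin.sum_univ_two, isoFundamental, k,
    Matrix.cons_val_zero, Matrix.cons_val_one]
  fin_cases i <;> fin_cases j <;>
    simp [Q, -Complex.ofReal_cos, -Complex.ofReal_sin] <;> ring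

theorem green_apply (M : Material) (ξ : Plane) (ω : ℝ) (x : Plane) (i j : Fin 2) :
    M.green ξ ω x i j = M.Q i 0 * M.Q j 0 * isoGreen M.a1 M.rho ω ξ x
      + M.Q i 1 * M.Q j 1 * isoGreen M.a2 M.rho ω ξ x := by
  rw [green, Matrix.add_apply, vstar_apply, vstar_apply, isoGreen_eq_add, isoGreen_eq_add]
  ring

end Material

/-! ### Assembly of the matrix Green's function from its two modes. -/

theorem contDiffAt_isoFundamental_dist1 {μ ρ ω : ℝ} (hμ : 0 < μ) (hρ : 0 < ρ) (hω : 0 < ω)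
    {ξ x : Plane} (hx : x ≠ ξ) :
    ContDiffAt ℝ 2 (fun x => isoFundamental μ ρ ω (dist1 x ξ)) x := by
  simp_rw [isoFundamental_dist1]
  exact contDiffAt_const.mul (contDiffAt_outgoingField (waveNumber_pos hμ hρ hω) hx)

theorem contDiffAt_isoFundamental_distImage {μ ρ ω : ℝ} (hμ : 0 < μ) (hρ : 0 < ρ) (hω : 0 < ω)
    {ξ x : Plane} (hx : x ≠ imagePoint ξ) :
    ContDiffAt ℝ 2 (fun x => isoFundamental μ ρ ω (distImage x ξ)) x := by
  simp_rw [isoFundamental_distImage]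
  exact contDiffAt_const.mul (contDiffAt_outgoingField (waveNumber_pos hμ hρ hω) hx)

theorem laplacian_isoFundamental_distImage {μ ρ ω : ℝ} (hμ : 0 < μ) (hρ : 0 < ρ) (hω : 0 < ω)
    {ξ x : Plane} (hx : x ≠ imagePoint ξ) :
    μ * (Δ (fun x => isoFundamental μ ρ ω (distImage x ξ))) x
      + ρ * ω ^ 2 * isoFundamental μ ρ ω (distImage x ξ) = 0 := by
  have hκ := waveNumber_pos hμ hρ hω
  have hk : (μ : ℂ) * waveNumber μ ρ ω ^ 2 = ρ * ω ^ 2 := by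
    exact_mod_cast mul_waveNumber_sq ω hμ hρ
  have he : (fun x => isoFundamental μ ρ ω (distImage x ξ))
      = (1 / (2 * Real.pi * μ) : ℂ) • outgoingField (waveNumber μ ρ ω) (imagePoint ξ) :=
    funext fun x => isoFundamental_distImage μ ρ ω ξ x
  rw [he, InnerProductSpace.laplacian_smul _ (contDiffAt_outgoingField hκ hx),
    laplacian_outgoingField hκ hx, isoFundamental_distImage, ← hk, smul_eq_mul]
  ring

theorem partialD_isoFundamental_boundary {μ ρ ω : ℝ} (hμ : 0 < μ) (hρ : 0 < ρ) (hω : 0 < ω)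
    {ξ x : Plane} (hξ : ξ ∈ lowerHalfPlane) (hx : x 1 = 0) :
    partialD 1 (fun x => isoFundamental μ ρ ω (dist1 x ξ)) x
      = -partialD 1 (fun x => isoFundamental μ ρ ω (distImage x ξ)) x := by
  have hκ := waveNumber_pos hμ hρ hω
  have h := partialD_outgoingField_boundary hκ hξ hx
  simp_rw [isoFundamental_dist1, isoFundamental_distImage]
  simp only [partialD] at h ⊢
  rw [fderiv_const_mul (differentiableAt_outgoingField hκ (ne_of_boundary hξ hx)),
    fderiv_const_mul (differentiableAt_outgoingField hκ (ne_imagePoint hξ hx.le))]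
  simp [h]

theorem partialD_const_mul_add {f g : Plane → ℂ} {x : Plane} (hf : DifferentiableAt ℝ f x)
    (hg : DifferentiableAt ℝ g x) (a b : ℂ) (i : Fin 2) :
    partialD i (fun y => a * f y + b * g y) x = a * partialD i f x + b * partialD i g x := by
  simp only [partialD]
  rw [fderiv_fun_add (hf.const_mul a) (hg.const_mul b), fderiv_const_mul hf, fderiv_const_mul hg]
  simp

theorem laplacian_const_mul_add {f g : Plane → ℂ} {x : Plane} (hf : ContDiffAt ℝ 2 f x)
    (hg : ContDiffAt ℝ 2 g x) (a b : ℂ) :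
    (Δ (fun y => a * f y + b * g y)) x = a * (Δ f) x + b * (Δ g) x := by
  have he : (fun y => a * f y + b * g y) = a • f + b • g := rfl
  rw [he, ContDiffAt.laplacian_add (f₁ := a • f) (f₂ := b • g) (hf.const_smul a) (hg.const_smul b),
    InnerProductSpace.laplacian_smul a hf, InnerProductSpace.laplacian_smul b hg]
  rfl

namespace Material

variable {M : Material} {ω : ℝ} {ξ : Plane}

theorem solvesMotion_correction (hc : 0 < M.c44) (hdet : 0 < M.c44 * M.K2 - M.R3 ^ 2)
    (hρ : 0 < M.rho) (hω : 0 < ω) (hξ : ξ ∈ lowerHalfPlane) (j : Fin 2) :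
    M.SolvesMotion ω lowerHalfPlane
      (fun x => M.correction ξ ω x 0 j) (fun x => M.correction ξ ω x 1 j) := by
  have h1 := a1_pos hc
  have h2 := a2_pos hc hdet
  simp only [correction, vstar_apply]
  have hne : ∀ x ∈ lowerHalfPlane, x ≠ imagePoint ξ := fun x hx => ne_imagePoint hξ (le_of_lt hx)
  have hcd : ∀ a b : ℂ, ContDiffOn ℝ 2 (fun x =>
      a * isoFundamental M.a1 M.rho ω (distImage x ξ)
        + b * isoFundamental M.a2 M.rho ω (distImage x ξ)) lowerHalfPlane := fun a b x hx =>
    ((contDiffAt_const.mul (contDiffAt_isoFundamental_distImage h1 hρ hω (hne x hx))).add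
      (contDiffAt_const.mul
        (contDiffAt_isoFundamental_distImage h2 hρ hω (hne x hx)))).contDiffWithinAt
  refine ⟨hcd _ _, hcd _ _, fun x hx => ?_⟩
  have c1 := contDiffAt_isoFundamental_distImage h1 hρ hω (hne x hx)
  have c2 := contDiffAt_isoFundamental_distImage h2 hρ hω (hne x hx)
  have l1 := laplacian_isoFundamental_distImage h1 hρ hω (hne x hx)
  have l2 := laplacian_isoFundamental_distImage h2 hρ hω (hne x hx)
  rw [laplacian_const_mul_add c1 c2, laplacian_const_mul_add c1 c2]
  set L1 := (Δ (fun x => isoFundamental M.a1 M.rho ω (distImage x ξ))) x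
  set L2 := (Δ (fun x => isoFundamental M.a2 M.rho ω (distImage x ξ))) x
  have e0 := M.elastic_phonon 0
  have e1 := M.elastic_phonon 1
  have f0 := M.elastic_phason 0
  have f1 := M.elastic_phason 1
  simp only [modulus, Matrix.cons_val_zero, Matrix.cons_val_one] at e0 e1 f0 f1
  constructor
  -- The eigenvector relations replace C by a_l in mode l, leaving a_l ΔΦ_l + ρω²Φ_l = 0 with
  -- weights Q_{jl} Q_{il}.
  · linear_combination M.Q j 0 * L1 * e0 + M.Q j 1 * L2 * e1
      + M.Q j 0 * M.Q 0 0 * l1 + M.Q j 1 * M.Q 0 1 * l2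
  · linear_combination M.Q j 0 * L1 * f0 + M.Q j 1 * L2 * f1
      + M.Q j 0 * M.Q 1 0 * l1 + M.Q j 1 * M.Q 1 1 * l2

theorem contDiffAt_green (hc : 0 < M.c44) (hdet : 0 < M.c44 * M.K2 - M.R3 ^ 2)
    (hρ : 0 < M.rho) (hω : 0 < ω) (hξ : ξ ∈ lowerHalfPlane) {x : Plane} (hx : x 1 ≤ 0)
    (hne : x ≠ ξ) (i j : Fin 2) : ContDiffAt ℝ 2 (fun y => M.green ξ ω y i j) x := by
  simp only [green_apply]
  exact (contDiffAt_const.mul (contDiffAt_isoGreen (a1_pos hc) hρ hω hξ hx hne)).add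
    (contDiffAt_const.mul (contDiffAt_isoGreen (a2_pos hc hdet) hρ hω hξ hx hne))

/-- Completeness ∑ q_l q_lᵀ = 1: it turns the point masses of the two modes into the Kronecker
delta. -/
theorem Q_orthonormal_rows (M : Material) (i j : Fin 2) :
    M.Q i 0 * M.Q j 0 + M.Q i 1 * M.Q j 1 = if i = j then 1 else 0 := by
  have h := congrFun (congrFun M.Q_mul_transpose i) j
  simpa [Matrix.mul_apply, Fin.sum_univ_two, Matrix.one_apply] using h

theorem solvesPointSource_green (hc : 0 < M.c44) (hdet : 0 < M.c44 * M.K2 - M.R3 ^ 2)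
    (hρ : 0 < M.rho) (hω : 0 < ω) (hξ : ξ ∈ lowerHalfPlane) :
    M.SolvesPointSource ω lowerHalfPlane ξ (M.green ξ ω) := by
  have h1 := a1_pos hc
  have h2 := a2_pos hc hdet
  refine ⟨fun i j => ?_, fun φ hφ hcs hs j => ?_⟩
  · simp only [green_apply]
    refine LocallyIntegrable.locallyIntegrableOn ?_ _
    exact ((locallyIntegrable_isoGreen h1 hρ hω ξ).smul (M.Q i 0 * M.Q j 0)).add
      ((locallyIntegrable_isoGreen h2 hρ hω ξ).smul (M.Q i 1 * M.Q j 1))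
  · have hφ2 := contDiff_two_of_contDiff_top hφ
    have i1 := (integrable_isoGreen_pairing h1 hρ hω ξ hφ2 hcs).integrableOn (s := lowerHalfPlane)
    have i2 := (integrable_isoGreen_pairing h2 hρ hω ξ hφ2 hcs).integrableOn (s := lowerHalfPlane)
    have p1 := integral_isoGreen_pairing h1 hρ hω hξ hφ2 hcs hs
    have p2 := integral_isoGreen_pairing h2 hρ hω hξ hφ2 hcs hs
    have e0 := M.elastic_phonon 0
    have e1 := M.elastic_phonon 1
    have f0 := M.elastic_phason 0
    have f1 := M.elastic_phason 1
    simp only [modulus, Matrix.cons_val_zero, Matrix.cons_val_one] at e0 e1 f0 f1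
    have key : ∀ i, ∫ x in lowerHalfPlane,
        (M.Q i 0 * M.Q j 0 * ((M.a1 : ℂ) * isoGreen M.a1 M.rho ω ξ x * (Δ φ) x
            + M.rho * ω ^ 2 * isoGreen M.a1 M.rho ω ξ x * φ x)
          + M.Q i 1 * M.Q j 1 * ((M.a2 : ℂ) * isoGreen M.a2 M.rho ω ξ x * (Δ φ) x
            + M.rho * ω ^ 2 * isoGreen M.a2 M.rho ω ξ x * φ x))
        = -(φ ξ * if j = i then 1 else 0) := by
      intro i
      rw [integral_add (i1.const_mul _) (i2.const_mul _), integral_const_mul, integral_const_mul,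
        p1, p2]
      have := M.Q_orthonormal_rows j i
      linear_combination (-φ ξ) * this
    constructor
    · rw [← key 0]
      congr 1 with x
      simp only [green_apply]
      linear_combination M.Q j 0 * isoGreen M.a1 M.rho ω ξ x * (Δ φ) x * e0
        + M.Q j 1 * isoGreen M.a2 M.rho ω ξ x * (Δ φ) x * e1
    · rw [← key 1]
      congr 1 with x
      simp only [green_apply]
      linear_combination M.Q j 0 * isoGreen M.a1 M.rho ω ξ x * (Δ φ) x * f0
        + M.Q j 1 * isoGreen M.a2 M.rho ω ξ x * (Δ φ) x * f1

theorem tractionFree_green (hc : 0 < M.c44) (hdet : 0 < M.c44 * M.K2 - M.R3 ^ 2)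
    (hρ : 0 < M.rho) (hω : 0 < ω) (hξ : ξ ∈ lowerHalfPlane) : M.TractionFree (M.green ξ ω) := by
  intro x hx j
  have h1 := a1_pos hc
  have h2 := a2_pos hc hdet
  have hne := ne_of_boundary hξ hx
  have d1 := (contDiffAt_isoGreen h1 hρ hω hξ hx.le hne).differentiableAt two_ne_zero
  have d2 := (contDiffAt_isoGreen h2 hρ hω hξ hx.le hne).differentiableAt two_ne_zero
  -- Every displacement has zero normal derivative, so the tractions vanish whatever the elastic
  -- constants.
  have hp : ∀ i, partialD 1 (fun y => M.green ξ ω y i j) x = 0 := by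
    intro i
    simp only [green_apply]
    rw [partialD_const_mul_add d1 d2, partialD_isoGreen_boundary h1 hρ hω hξ hx,
      partialD_isoGreen_boundary h2 hρ hω hξ hx]
    simp
  refine ⟨fun i => (contDiffAt_green hc hdet hρ hω hξ hx.le hne i j).differentiableAt two_ne_zero,
    ?_, ?_⟩
  · simp [phononTraction, phononStress, Fin.sum_univ_two, unitVec, hp]
  · simp [phasonTraction, phasonStress, Fin.sum_univ_two, unitVec, hp]

theorem radiating_green (hc : 0 < M.c44) (hdet : 0 < M.c44 * M.K2 - M.R3 ^ 2)
    (hρ : 0 < M.rho) (hω : 0 < ω) (ξ : Plane) (Ω : Set Plane) :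
    M.Radiating ω Ω (M.green ξ ω) := by
  intro l j
  have hm := modulus_pos hc hdet l
  have hk : M.k ω l = waveNumber (M.modulus l) M.rho ω := by fin_cases l <;> rfl
  have hT : M.Q.transpose * M.Q = 1 := mul_eq_one_comm.1 M.Q_mul_transpose
  have ho : ∀ m, M.Q 0 l * M.Q 0 m + M.Q 1 l * M.Q 1 m = if l = m then 1 else 0 := fun m => by
    have h := congrFun (congrFun hT l) m
    simpa [Matrix.mul_apply, Fin.sum_univ_two, Matrix.one_apply] using h
  -- By orthonormality of the columns, row l of Qᵀ g* contains mode l alone, hence a single wave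
  -- number.
  have he : (fun x => (M.Q.transpose * M.green ξ ω x) l j)
      = fun x => M.Q j l * isoGreen (M.modulus l) M.rho ω ξ x := by
    ext x
    have o0 := ho 0
    have o1 := ho 1
    simp only [Matrix.mul_apply, Fin.sum_univ_two, Matrix.transpose_apply, green_apply]
    have : ∀ g0 g1 : ℂ, M.Q 0 l * (M.Q 0 0 * M.Q j 0 * g0 + M.Q 0 1 * M.Q j 1 * g1)
        + M.Q 1 l * (M.Q 1 0 * M.Q j 0 * g0 + M.Q 1 1 * M.Q j 1 * g1)
        = (if l = 0 then 1 else 0) * (M.Q j 0 * g0) + (if l = 1 then 1 else 0) * (M.Q j 1 * g1) := by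
      intro g0 g1
      rw [← o0, ← o1]
      ring
    rw [this]
    fin_cases l <;> simp [modulus]
  rw [he, hk]
  exact (sommerfeld_isoGreen hm hρ hω ξ Ω).const_mul _
    (eventually_differentiableAt_isoGreen hm hρ hω ξ)

theorem partialD_direct_boundary (hc : 0 < M.c44) (hdet : 0 < M.c44 * M.K2 - M.R3 ^ 2)
    (hρ : 0 < M.rho) (hω : 0 < ω) (hξ : ξ ∈ lowerHalfPlane) {x : Plane} (hx : x 1 = 0)
    (i j : Fin 2) :
    DifferentiableAt ℝ (fun y => M.direct ξ ω y i j) x ∧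
    DifferentiableAt ℝ (fun y => M.correction ξ ω y i j) x ∧
    partialD 1 (fun y => M.direct ξ ω y i j) x
      = -partialD 1 (fun y => M.correction ξ ω y i j) x := by
  have h1 := a1_pos hc
  have h2 := a2_pos hc hdet
  have hne := ne_of_boundary hξ hx
  have hne' := ne_imagePoint hξ hx.le
  have d1 := (contDiffAt_isoFundamental_dist1 h1 hρ hω hne).differentiableAt two_ne_zero
  have d2 := (contDiffAt_isoFundamental_dist1 h2 hρ hω hne).differentiableAt two_ne_zero
  have c1 := (contDiffAt_isoFundamental_distImage h1 hρ hω hne').differentiableAt two_ne_zero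
  have c2 := (contDiffAt_isoFundamental_distImage h2 hρ hω hne').differentiableAt two_ne_zero
  simp only [direct, correction, vstar_apply]
  refine ⟨(d1.const_mul _).fun_add (d2.const_mul _), (c1.const_mul _).fun_add (c2.const_mul _), ?_⟩
  rw [partialD_const_mul_add d1 d2, partialD_const_mul_add c1 c2,
    partialD_isoFundamental_boundary h1 hρ hω hξ hx, partialD_isoFundamental_boundary h2 hρ hω hξ hx]
  ring

theorem vstar_of_uncoupled (hR : M.R3 = 0) (r ω : ℝ) :
    M.vstar r ω
      = !![isoFundamental M.c44 M.rho ω r, 0; 0, isoFundamental M.K2 M.rho ω r] := by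
  have hadd := M.a1_add_a2
  by_cases h : M.c44 = M.a1
  · have ha2 : M.a2 = M.K2 := by linarith
    have hpsi : M.psi = 0 := by rw [psi, if_pos ⟨hR, h⟩]
    ext i j
    rw [vstar_apply, ← h, ha2]
    fin_cases i <;> fin_cases j <;> simp [Q, hpsi]
  -- Here the modes come in the opposite order, a₁ = K₂ and a₂ = c₄₄, and the quarter turn Q swaps
  -- the axes back.
  · have hpsi : M.psi = Real.pi / 2 := by
      rw [psi, if_neg fun h' => h h'.2, hR, zero_div, Real.arccos_zero]
    have ha1 : M.a1 = M.K2 := by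
      have := M.eigenvector_psi.2
      rw [hpsi, Real.cos_pi_div_two, Real.sin_pi_div_two] at this
      linarith
    have ha2 : M.a2 = M.c44 := by linarith
    ext i j
    rw [vstar_apply, ha1, ha2]
    fin_cases i <;> fin_cases j <;> simp [Q, hpsi, -Complex.ofReal_cos, -Complex.ofReal_sin]

theorem green_of_uncoupled (hR : M.R3 = 0) (ω : ℝ) (ξ x : Plane) :
    M.green ξ ω x = !![isoGreen M.c44 M.rho ω ξ x, 0; 0, isoGreen M.K2 M.rho ω ξ x] := by
  rw [green, vstar_of_uncoupled hR, vstar_of_uncoupled hR, isoGreen_eq_add, isoGreen_eq_add]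
  simp

end Material

end Quasicrystal

end

open Quasicrystal in
theorem mainTheorem2 (M : Material) (ω : ℝ) (ξ : Plane)
    (hc : 0 < M.c44) (hK : 0 < M.K2) (hR : 0 ≤ M.R3) (hdet : 0 < M.c44 * M.K2 - M.R3 ^ 2)
    (hρ : 0 < M.rho) (hω : 0 < ω) (hξ : ξ ∈ lowerHalfPlane) :
    -- the decomposition: free-space term plus a correction that solves the source-free equations
    (∀ x, M.green ξ ω x = M.direct ξ ω x + M.correction ξ ω x) ∧
    (∀ j, M.SolvesMotion ω lowerHalfPlane
      (fun x => M.correction ξ ω x 0 j) (fun x => M.correction ξ ω x 1 j)) ∧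
    -- regularity up to the boundary, away from the source
    (∀ x : Plane, x 1 ≤ 0 → x ≠ ξ → ∀ i j, ContDiffAt ℝ 2 (fun y => M.green ξ ω y i j) x) ∧
    -- the Green's function
    M.SolvesPointSource ω lowerHalfPlane ξ (M.green ξ ω) ∧
    M.TractionFree (M.green ξ ω) ∧
    M.Radiating ω lowerHalfPlane (M.green ξ ω) ∧
    -- the normal derivatives of the two terms are opposite on the boundary
    (∀ x : Plane, x 1 = 0 → ∀ i j,
      DifferentiableAt ℝ (fun y => M.direct ξ ω y i j) x ∧
      DifferentiableAt ℝ (fun y => M.correction ξ ω y i j) x ∧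
      partialD 1 (fun y => M.direct ξ ω y i j) x
        = -partialD 1 (fun y => M.correction ξ ω y i j) x) ∧
    -- the uncoupled case
    (M.R3 = 0 →
      (∀ r : ℝ, M.vstar r ω
        = !![isoFundamental M.c44 M.rho ω r, 0; 0, isoFundamental M.K2 M.rho ω r]) ∧
      (∀ x, M.green ξ ω x
        = !![isoGreen M.c44 M.rho ω ξ x, 0; 0, isoGreen M.K2 M.rho ω ξ x]) ∧
      IsIsotropicGreen M.c44 M.rho ω ξ (isoGreen M.c44 M.rho ω ξ) ∧
      IsIsotropicGreen M.K2 M.rho ω ξ (isoGreen M.K2 M.rho ω ξ)) :=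
  ⟨fun _ => rfl,
    fun j => Material.solvesMotion_correction hc hdet hρ hω hξ j,
    fun _ hx hne i j => Material.contDiffAt_green hc hdet hρ hω hξ hx hne i j,
    Material.solvesPointSource_green hc hdet hρ hω hξ,
    Material.tractionFree_green hc hdet hρ hω hξ,
    Material.radiating_green hc hdet hρ hω ξ _,
    fun _ hx i j => Material.partialD_direct_boundary hc hdet hρ hω hξ hx i j,
    fun hR0 => ⟨fun r => Material.vstar_of_uncoupled hR0 r ω,
      fun x => Material.green_of_uncoupled hR0 ω ξ x,
      isIsotropicGreen_isoGreen hc hρ hω hξ, isIsotropicGreen_isoGreen hK hρ hω hξ⟩⟩
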